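/- **Theorem.** Let $k\ge 0$ be a fixed integer. An instance of $k$-FTP (Fault-Tolerant Path with $k$ faults) consists of a finite directed graph $D=(V,A)$, in which parallel arcs are allowed, non-negative rational arc weights $w\in\mathbb{Q}_{\ge 0}^A$, two vertices $s,t\in V$ and a set $M\subseteq A$ of vulnerable arcs. A set $S\subseteq A$ is *feasible* if $S\setminus F$ contains a directed $s$-$t$ path for every $F\subseteq M$ with $|F|\le k$. The task is to find a feasible set $S$ of minimum total weight $w(S)=\sum_{e\in S}w(e)$, or to report that there is no feasible set. There is an algorithm (a deterministic multi-stack, equivalently multi-tape, Turing machine) which solves $k$-FTP on every instance whose graph $D$ is acyclic, in a number of steps that is bounded by a polynomial in the length of the input. Here the polynomial may depend on $k$, and the input lists the vertices (one symbol for each), the terminals $s$ and $t$, and the arcs, each with its two ends, the numerator and denominator of its weight in binary, and one bit telling whether it is vulnerable. The output is the characteristic vector of an optimal set $S$, or a special symbol if there is no feasible set. -/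

import Mathlib

open Computability Turing

/-- An instance of the Fault-Tolerant Path problem, the number `k` of faults excepted: a finite
directed multigraph with vertex set `Fin n` and arc set `Fin m` (parallel arcs are allowed), with
non-negative rational arc weights, two terminals `s`, `t` and a set `M` of vulnerable arcs. -/
structure FTPInstance where
  /-- the number of vertices -/
  n : ℕ
  /-- the number of arcs -/
  m : ℕ
  /-- the vertex that an arc leaves -/
  tail : Fin m → Fin n
  /-- the vertex that an arc enters -/
  head : Fin m → Fin n
  /-- the weight (cost) of an arc -/
  weight : Fin m → ℚ≥0
  /-- the source -/
  s : Fin n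
  /-- the target -/
  t : Fin n
  /-- the vulnerable arcs -/
  M : Finset (Fin m)

namespace FTPInstance

/-- `I.Adj X u v`: some arc of `X` leads from `u` to `v`. -/
def Adj (I : FTPInstance) (X : Finset (Fin I.m)) (u v : Fin I.n) : Prop :=
  ∃ e ∈ X, I.tail e = u ∧ I.head e = v

/-- The arc set `X` contains a directed path from `u` to `v`. The path of length zero, from a
vertex to itself, counts. -/
def HasPath (I : FTPInstance) (X : Finset (Fin I.m)) (u v : Fin I.n) : Prop :=
  Relation.ReflTransGen (I.Adj X) u v

/-- The digraph has no directed cycle, i.e. no closed directed walk of positive length. -/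
def IsAcyclic (I : FTPInstance) : Prop :=
  ∀ v, ¬ Relation.TransGen (I.Adj Finset.univ) v v

/-- The instances whose digraph is acyclic. -/
abbrev OnDAG : Type := {I : FTPInstance // I.IsAcyclic}

/-- `S \ F` contains an `s`-`t` path for every set `F` of at most `k` vulnerable arcs. -/
def IsFeasible (I : FTPInstance) (k : ℕ) (S : Finset (Fin I.m)) : Prop :=
  ∀ F ⊆ I.M, F.card ≤ k → I.HasPath (S \ F) I.s I.t

/-- The total weight of an arc set. -/
def cost (I : FTPInstance) (S : Finset (Fin I.m)) : ℚ≥0 :=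
  ∑ e ∈ S, I.weight e

/-- A correct answer for `k` faults: a feasible arc set of minimum cost, or `none` if there is no
feasible arc set. -/
def IsAnswer (I : FTPInstance) (k : ℕ) : Option (Finset (Fin I.m)) → Prop
  | none => ∀ S, ¬ I.IsFeasible k S
  | some S => I.IsFeasible k S ∧ ∀ T, I.IsFeasible k T → I.cost S ≤ I.cost T

/-- A natural number in binary (least significant bit first), closed by a comma. -/
def natCode (x : ℕ) : List Γ' :=
  (encodeNat x).map Γ'.bit ++ [Γ'.comma]

/-- An arc: its two ends, numerator and denominator of its weight, all in binary, and one bit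
which tells whether it is vulnerable. -/
def arcCode (I : FTPInstance) (e : Fin I.m) : List Γ' :=
  Γ'.bra :: (natCode (I.tail e) ++ natCode (I.head e) ++ natCode (I.weight e).num ++
    natCode (I.weight e).den ++ [Γ'.bit (decide (e ∈ I.M)), Γ'.ket])

/-- The input word of an instance: one blank for each vertex, the terminals, the list of arcs. -/
def encode (I : FTPInstance) : List Γ' :=
  List.replicate I.n Γ'.blank ++ natCode I.s ++ natCode I.t ++
    (List.finRange I.m).flatMap I.arcCode

/-- The output word of an answer: the characteristic vector of the arc set, or a single blank if
the answer is `none`. -/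
def encodeAnswer {m : ℕ} : Option (Finset (Fin m)) → List Γ'
  | none => [Γ'.blank]
  | some S => List.ofFn fun e => Γ'.bit (decide (e ∈ S))

/-! The encodings lose no information. -/

theorem natCode_append_inj {x y : ℕ} {l r : List Γ'} (h : natCode x ++ l = natCode y ++ r) :
    x = y ∧ l = r := by
  have key : ∀ (a b : List Bool), a.map Γ'.bit ++ Γ'.comma :: l = b.map Γ'.bit ++ Γ'.comma :: r →
      a = b ∧ l = r := by
    intro a
    induction a with
    | nil => intro b hb; cases b <;> simp_all
    | cons c a ih =>
      intro b hb
      cases b with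
      | nil => simp at hb
      | cons d b =>
        simp only [List.map_cons, List.cons_append, List.cons.injEq, Γ'.bit.injEq] at hb
        obtain ⟨h1, h2⟩ := ih b hb.2
        exact ⟨by rw [hb.1, h1], h2⟩
  obtain ⟨h1, h2⟩ := key (encodeNat x) (encodeNat y) (by simpa [natCode] using h)
  exact ⟨encodingNatBool.encode_injective h1, h2⟩

theorem natCode_head (x : ℕ) : (natCode x).head? ≠ some Γ'.blank := by
  unfold natCode
  cases encodeNat x <;> simp

theorem replicate_blank_inj {a b : ℕ} {l r : List Γ'} (hl : l.head? ≠ some Γ'.blank)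
    (hr : r.head? ≠ some Γ'.blank)
    (h : List.replicate a Γ'.blank ++ l = List.replicate b Γ'.blank ++ r) : a = b ∧ l = r := by
  induction a generalizing b with
  | zero =>
    cases b with
    | zero => simpa using h
    | succ b => simp [List.replicate_succ] at h; simp [h] at hl
  | succ a ih =>
    cases b with
    | zero => simp [List.replicate_succ] at h; simp [← h] at hr
    | succ b =>
      simp only [List.replicate_succ, List.cons_append, List.cons.injEq, true_and] at h
      obtain ⟨h1, h2⟩ := ih h
      exact ⟨by rw [h1], h2⟩

theorem flatMap_code_inj {n : ℕ} (L L' : List (Fin n × Fin n × ℚ≥0 × Bool))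
    (h : (L.flatMap fun a => Γ'.bra :: (natCode a.1 ++ natCode a.2.1 ++
        natCode a.2.2.1.num ++ natCode a.2.2.1.den ++ [Γ'.bit a.2.2.2, Γ'.ket])) =
      (L'.flatMap fun a => Γ'.bra :: (natCode a.1 ++ natCode a.2.1 ++
        natCode a.2.2.1.num ++ natCode a.2.2.1.den ++ [Γ'.bit a.2.2.2, Γ'.ket]))) :
    L = L' := by
  induction L generalizing L' with
  | nil => cases L' <;> simp_all
  | cons a L ih =>
    cases L' with
    | nil => simp at h
    | cons b L' =>
      simp only [List.flatMap_cons, List.cons_append, List.append_assoc, List.cons.injEq,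
        true_and] at h
      obtain ⟨h1, h⟩ := natCode_append_inj h
      obtain ⟨h2, h⟩ := natCode_append_inj h
      obtain ⟨h3, h⟩ := natCode_append_inj h
      obtain ⟨h4, h⟩ := natCode_append_inj h
      simp only [List.nil_append, List.cons.injEq, Γ'.bit.injEq, true_and] at h
      obtain ⟨h5, h6⟩ := h
      have ih := ih L' (by simpa only [List.append_assoc] using h6)
      obtain ⟨a1, a2, a3, a4⟩ := a
      obtain ⟨b1, b2, b3, b4⟩ := b
      obtain rfl := Fin.ext h1
      obtain rfl := Fin.ext h2
      obtain rfl := NNRat.ext_num_den h3 h4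
      obtain rfl := h5
      rw [ih]

theorem encode_injective : Function.Injective encode := by
  rintro ⟨n, m, tl, hd, w, s, t, M⟩ ⟨n', m', tl', hd', w', s', t', M'⟩ h
  simp only [encode, List.append_assoc] at h
  obtain ⟨rfl, h⟩ := replicate_blank_inj
    (by have := natCode_head s; unfold natCode at *; cases hs : encodeNat s <;> simp_all)
    (by have := natCode_head s'; unfold natCode at *; cases hs : encodeNat s' <;> simp_all) h
  obtain ⟨hs, h⟩ := natCode_append_inj h
  obtain ⟨ht, h⟩ := natCode_append_inj h
  obtain rfl := Fin.ext hs
  obtain rfl := Fin.ext ht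
  have key : ∀ {p : ℕ} (tl hd : Fin p → Fin n) (w : Fin p → ℚ≥0) (M : Finset (Fin p)),
      (List.finRange p).flatMap (arcCode ⟨n, p, tl, hd, w, s, t, M⟩) =
        (List.ofFn fun e => (tl e, hd e, w e, decide (e ∈ M))).flatMap
          fun a : Fin n × Fin n × ℚ≥0 × Bool => Γ'.bra :: (natCode a.1 ++ natCode a.2.1 ++
            natCode a.2.2.1.num ++ natCode a.2.2.1.den ++ [Γ'.bit a.2.2.2, Γ'.ket]) := by
    intro p tl hd w M
    rw [List.ofFn_eq_map, List.flatMap_map]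
    rfl
  rw [key, key] at h
  have h := List.ofFn_inj'.1 (flatMap_code_inj _ _ h)
  obtain ⟨rfl, h⟩ := Sigma.mk.inj_iff.1 h
  have h := fun e => congrFun (eq_of_heq h) e
  simp only [Prod.mk.injEq, decide_eq_decide] at h
  obtain rfl : tl = tl' := funext fun e => (h e).1
  obtain rfl : hd = hd' := funext fun e => (h e).2.1
  obtain rfl : w = w' := funext fun e => (h e).2.2.1
  obtain rfl : M = M' := Finset.ext fun e => (h e).2.2.2
  rfl

theorem encodeAnswer_injective {m : ℕ} : Function.Injective (encodeAnswer (m := m)) := by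
  have key : ∀ S : Finset (Fin m), encodeAnswer (some S) ≠ encodeAnswer (m := m) none := by
    intro S h
    have : Γ'.blank ∈ encodeAnswer (some S) := by rw [h]; simp [encodeAnswer]
    simp [encodeAnswer, List.mem_ofFn] at this
  rintro (_ | S) (_ | T) h
  · rfl
  · exact (key T h.symm).elim
  · exact (key S h).elim
  · have h := List.ofFn_injective h
    refine congrArg some (Finset.ext fun e => ?_)
    simpa using congrFun h e

end FTPInstance

/-! ### A structured language for stack machines -/

/-! Combinatorial core. Give every vulnerable arc of a set `S` capacity 1 and every other arc of `S`
capacity `k + 1`. Then `S` is feasible exactly if it carries an integral `s`-`t` flow of value `k +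
1`. An `s`-`t` cut of capacity at most `k` contains no safe arc of `S`, so its arcs in `S` form a
fault set that disconnects `s` from `t`. Conversely, at most `k` faults cannot block such a flow. A
cheapest feasible set is therefore a cheapest support of such a flow, where an arc is paid once,
however many units use it.

On an acyclic graph a flow is the same as `k + 1` tokens travelling from `s` to `t` while the arcs
are offered once each, in topological order. When an arc is offered, any number of the tokens on its
tail may cross it, but at most one if the arc is vulnerable. One pass suffices because everything
that will ever enter the tail has arrived by then. A dynamic program keeps one cheapest list of used
arcs for each configuration of the tokens. For fixed `k` the number of configurations is polynomial.

Flow to tokens is `IsFeasible.exists_isFlow` (augmentation, via `exists_isFlow_succ_or_cut`)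
followed by `IsFlow.exists_tokenRun`. Tokens to feasibility is `isFeasible_of_tokenRun`.
`TokenRun.of_mem_table` and `TokenRun.mem_table` say that the table holds runs only, and cheapest
ones. `IsAcyclic.exists_isAnswer` combines them.

Machine model. Structured programs on six stacks are compiled to a `FinTM2` by `Runs.reachesIn`.
Data are binary trees, written in preorder on one stack. `PolyTime` is closed under composition,
pairing, case distinction and folds whose intermediate states stay polynomially small, so the
running time of the algorithm follows from its definition and a few size bounds. -/

/-- The stacks of the machine: input, output, the value stack and three auxiliary stacks. -/
inductive Stk
  | inp | out | val | aux | buf | cnt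
  deriving DecidableEq

instance : Fintype Stk where
  elems := {.inp, .out, .val, .aux, .buf, .cnt}
  complete := fun k => by cases k <;> simp

/-- The contents of the stacks. -/
abbrev Store := Stk → List Γ'

/-- Structured programs that work on the stacks. -/
inductive Prog
  /-- put `f (top of k)` on the stack `j` -/
  | push (j k : Stk) (f : Option Γ' → Γ')
  | pop (k : Stk)
  | seq (P Q : Prog)
  /-- branch on the top of the stack `k` -/
  | ite (k : Stk) (p : Option Γ' → Bool) (P Q : Prog)
  | loop (k : Stk) (p : Option Γ' → Bool) (P : Prog)

namespace Prog

/-- `Runs P S S' t`: the program `P` takes the store `S` to the store `S'` in at most `t` steps. -/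
inductive Runs : Prog → Store → Store → ℕ → Prop
  | push {j k f S t} (h : 1 ≤ t) :
      Runs (push j k f) S (Function.update S j (f (S k).head? :: S j)) t
  | pop {k S t} (h : 1 ≤ t) : Runs (pop k) S (Function.update S k (S k).tail) t
  | seq {P Q S S₁ S₂ t₁ t₂ t} (h₁ : Runs P S S₁ t₁) (h₂ : Runs Q S₁ S₂ t₂) (h : t₁ + t₂ ≤ t) :
      Runs (seq P Q) S S₂ t
  | ite_true {k p P Q S S' t' t} (hp : p (S k).head? = true) (h₁ : Runs P S S' t')
      (h : t' + 1 ≤ t) : Runs (ite k p P Q) S S' t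
  | ite_false {k p P Q S S' t' t} (hp : p (S k).head? = false) (h₁ : Runs Q S S' t')
      (h : t' + 1 ≤ t) : Runs (ite k p P Q) S S' t
  | loop_done {k p P S t} (hp : p (S k).head? = false) (h : 1 ≤ t) : Runs (loop k p P) S S t
  | loop_step {k p P S S₁ S₂ t₁ t₂ t} (hp : p (S k).head? = true) (h₁ : Runs P S S₁ t₁)
      (h₂ : Runs (loop k p P) S₁ S₂ t₂) (h : t₁ + t₂ + 1 ≤ t) : Runs (loop k p P) S S₂ t

/-- The labels of the machine that runs a program. -/
def Label : Prog → Type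
  | push _ _ _ => Unit
  | pop _ => Unit
  | seq P Q => P.Label ⊕ Q.Label
  | ite _ _ P Q => Option (P.Label ⊕ Q.Label)
  | loop _ _ P => Option P.Label

instance fintypeLabel : (P : Prog) → Fintype P.Label
  | push _ _ _ => inferInstanceAs (Fintype Unit)
  | pop _ => inferInstanceAs (Fintype Unit)
  | seq P Q => letI := fintypeLabel P; letI := fintypeLabel Q
    inferInstanceAs (Fintype (P.Label ⊕ Q.Label))
  | ite _ _ P Q => letI := fintypeLabel P; letI := fintypeLabel Q
    inferInstanceAs (Fintype (Option (P.Label ⊕ Q.Label)))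
  | loop _ _ P => letI := fintypeLabel P; inferInstanceAs (Fintype (Option P.Label))

/-- The label at which a program starts. -/
def entry : (P : Prog) → P.Label
  | push _ _ _ => ()
  | pop _ => ()
  | seq P _ => Sum.inl P.entry
  | ite _ _ _ _ => none
  | loop _ _ _ => none

/-- The machine statements of a program whose labels are embedded into `L` by `emb` and which
continues at the label `exit`. -/
def stmt {L : Type} : (P : Prog) → (P.Label → L) → L → P.Label →
    TM2.Stmt (fun _ : Stk => Γ') L (Option Γ')
  | push j k f, _, exit, _ =>
    .peek k (fun _ x => x) (.push j f (.load (fun _ => none) (.goto fun _ => exit)))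
  | pop k, _, exit, _ => .pop k (fun v _ => v) (.goto fun _ => exit)
  | seq P Q, emb, exit, l =>
    match l with
    | Sum.inl l => P.stmt (fun l => emb (Sum.inl l)) (emb (Sum.inr Q.entry)) l
    | Sum.inr l => Q.stmt (fun l => emb (Sum.inr l)) exit l
  | ite k p P Q, emb, exit, l =>
    match l with
    | none => .peek k (fun _ x => x) (.branch p
        (.load (fun _ => none) (.goto fun _ => emb (some (Sum.inl P.entry))))
        (.load (fun _ => none) (.goto fun _ => emb (some (Sum.inr Q.entry)))))
    | some (Sum.inl l) => P.stmt (fun l => emb (some (Sum.inl l))) exit l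
    | some (Sum.inr l) => Q.stmt (fun l => emb (some (Sum.inr l))) exit l
  | loop k p P, emb, exit, l =>
    match l with
    | none => .peek k (fun _ x => x) (.branch p
        (.load (fun _ => none) (.goto fun _ => emb (some P.entry)))
        (.load (fun _ => none) (.goto fun _ => exit)))
    | some l => P.stmt (fun l => emb (some l)) (emb none) l

/-- Reachability within a bounded number of machine steps. -/
def ReachesIn {L : Type} (M : L → TM2.Stmt (fun _ : Stk => Γ') L (Option Γ'))
    (a b : TM2.Cfg (fun _ : Stk => Γ') L (Option Γ')) (t : ℕ) : Prop :=
  ∃ n ≤ t, (flip bind (TM2.step M))^[n] (some a) = some b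

theorem ReachesIn.step {L : Type} {M : L → TM2.Stmt (fun _ : Stk => Γ') L (Option Γ')}
    {a b : TM2.Cfg (fun _ : Stk => Γ') L (Option Γ')} {t : ℕ} (h : TM2.step M a = some b)
    (ht : 1 ≤ t) : ReachesIn M a b t :=
  ⟨1, ht, h⟩

theorem ReachesIn.trans {L : Type} {M : L → TM2.Stmt (fun _ : Stk => Γ') L (Option Γ')}
    {a b c : TM2.Cfg (fun _ : Stk => Γ') L (Option Γ')} {t₁ t₂ t : ℕ} (h₁ : ReachesIn M a b t₁)
    (h₂ : ReachesIn M b c t₂) (ht : t₁ + t₂ ≤ t) : ReachesIn M a c t := by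
  obtain ⟨n₁, hn₁, e₁⟩ := h₁
  obtain ⟨n₂, hn₂, e₂⟩ := h₂
  exact ⟨n₂ + n₁, by omega, by rw [Function.iterate_add_apply, e₁, e₂]⟩

/-- Induction on the run. The embedding and the exit label vary because a subprogram occupies part
of the labels of the whole program and continues at a label of its parent. The register is `none` at
the start and at the end of every instruction, so runs can be concatenated. -/
theorem Runs.reachesIn {P : Prog} {S S' : Store} {t : ℕ} (h : Runs P S S' t) {L : Type}
    {M : L → TM2.Stmt (fun _ : Stk => Γ') L (Option Γ')} (emb : P.Label → L) (exit : L)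
    (hM : ∀ l, M (emb l) = P.stmt emb exit l) :
    ReachesIn M ⟨some (emb P.entry), none, S⟩ ⟨some exit, none, S'⟩ t := by
  induction h generalizing exit with
  | push h =>
    refine .step ?_ h
    simp [hM, stmt]
  | pop h =>
    refine .step ?_ h
    simp [hM, stmt]
  | @seq P Q S S₁ S₂ t₁ t₂ t h₁ h₂ h ih₁ ih₂ =>
    exact (ih₁ (fun l => emb (Sum.inl l)) (emb (Sum.inr Q.entry)) fun l => hM (Sum.inl l)).trans
      (ih₂ (fun l => emb (Sum.inr l)) exit fun l => hM (Sum.inr l)) h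
  | @ite_true k p P Q S S' t' t hp h₁ h ih =>
    refine ReachesIn.trans (t₁ := 1) (.step ?_ le_rfl)
      (ih (fun l => emb (some (Sum.inl l))) exit fun l => hM (some (Sum.inl l))) (by omega)
    simp only [TM2.step, hM]
    simp [stmt, entry, hp]
  | @ite_false k p P Q S S' t' t hp h₁ h ih =>
    refine ReachesIn.trans (t₁ := 1) (.step ?_ le_rfl)
      (ih (fun l => emb (some (Sum.inr l))) exit fun l => hM (some (Sum.inr l))) (by omega)
    simp only [TM2.step, hM]
    simp [stmt, entry, hp]
  | @loop_done k p P S t hp h =>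
    refine .step ?_ h
    simp only [TM2.step, hM]
    simp [stmt, entry, hp]
  | @loop_step k p P S S₁ S₂ t₁ t₂ t hp h₁ h₂ h ih₁ ih₂ =>
    refine ReachesIn.trans (t₁ := 1) (.step ?_ le_rfl)
      ((ih₁ (fun l => emb (some l)) (emb none) fun l => hM (some l)).trans (ih₂ emb exit hM)
        le_rfl) (by omega)
    simp only [TM2.step, hM]
    simp [stmt, entry, hp]

/-- The machine that runs a program and halts. -/
def machine (P : Prog) : FinTM2 where
  K := Stk
  k₀ := Stk.inp
  k₁ := Stk.out
  Γ _ := Γ'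
  Λ := Option P.Label
  main := some P.entry
  σ := Option Γ'
  initialState := none
  Γk₀Fin := inferInstanceAs (Fintype Γ')
  m := fun
    | none => .halt
    | some l => P.stmt some none l

/-- A program which takes every input to the right output, in polynomial time, yields a machine
that does so. -/
theorem nonempty_computable {α β : Type} (P : Prog) (ea : α → List Γ') (eb : β → List Γ')
    (f : α → β) (p : Polynomial ℕ)
    (h : ∀ a, Runs P (Function.update (fun _ => []) Stk.inp (ea a))
      (Function.update (fun _ => []) Stk.out (eb (f a))) (p.eval (ea a).length)) :
    Nonempty (TM2ComputableInPolyTime ea eb f) := by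
  have key : ∀ a, ∃ n ≤ (p + 1).eval (ea a).length,
      (flip bind P.machine.step)^[n] (some (initList P.machine (ea a))) =
        some (haltList P.machine (eb (f a))) := by
    intro a
    have h₁ := (h a).reachesIn (M := P.machine.m) some none fun l => rfl
    -- The exit label of the program still has to execute `halt`; this is the `+ 1` in the time
    -- bound.
    have h₂ : ReachesIn P.machine.m
        ⟨some none, none, Function.update (fun _ => []) Stk.out (eb (f a))⟩
        ⟨none, none, Function.update (fun _ => []) Stk.out (eb (f a))⟩ 1 := .step rfl le_rfl
    obtain ⟨n, hn, e⟩ := h₁.trans h₂ le_rfl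
    refine ⟨n, by simpa using hn, ?_⟩
    have e₁ : initList P.machine (ea a) = (⟨some (some P.entry), none,
        Function.update (fun _ => []) Stk.inp (ea a)⟩ :
          TM2.Cfg (fun _ : Stk => Γ') (Option P.Label) (Option Γ')) := by
      unfold initList
      congr 1
      funext k
      cases k <;> rfl
    have e₂ : haltList P.machine (eb (f a)) = (⟨none, none,
        Function.update (fun _ => []) Stk.out (eb (f a))⟩ :
          TM2.Cfg (fun _ : Stk => Γ') (Option P.Label) (Option Γ')) := by
      unfold haltList
      congr 1
      funext k
      cases k <;> rfl
    rw [e₁, e₂]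
    exact e
  choose n hn e using key
  refine ⟨{ tm := P.machine
            inputAlphabet := Equiv.refl _
            outputAlphabet := Equiv.refl _
            time := p + 1
            outputsFun := fun a => ⟨⟨n a, ?_⟩, hn a⟩ }⟩
  have h₁ : ∀ l : List Γ', List.map (Equiv.refl Γ').invFun l = l := fun l => List.map_id l
  refine Eq.trans ?_ ((e a).trans ?_)
  · exact congrArg (fun l => (flip bind P.machine.step)^[n a] (some (initList P.machine l))) (h₁ _)
  · exact congrArg (fun l => some (haltList P.machine l)) (h₁ _).symm

end Prog

/-! ### Binary trees on a stack -/

/-- The labels of the leaves of a tree. -/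
inductive LeafSym
  | nil
  | bit (b : Bool)
  | bra
  | comma
  deriving DecidableEq

/-- Labels of leaves as stack symbols; the symbol `Γ'.ket` is left for the inner nodes. -/
def LeafSym.toΓ' : LeafSym → Γ'
  | nil => Γ'.blank
  | bit b => Γ'.bit b
  | bra => Γ'.bra
  | comma => Γ'.comma

theorem LeafSym.toΓ'_ne_ket (a : LeafSym) : a.toΓ' ≠ Γ'.ket := by cases a <;> simp [toΓ']

/-- Binary trees with labelled leaves. -/
inductive BinTree
  | leaf (a : LeafSym)
  | node (l r : BinTree)

namespace BinTree

/-- The preorder code of a tree. -/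
def code : BinTree → List Γ'
  | leaf a => [a.toΓ']
  | node l r => Γ'.ket :: (l.code ++ r.code)

/-- The number of nodes. -/
def size : BinTree → ℕ
  | leaf _ => 1
  | node l r => l.size + r.size + 1

theorem length_code (d : BinTree) : d.code.length = d.size := by
  induction d with
  | leaf a => rfl
  | node l r hl hr => simp [code, size, hl, hr]

theorem size_pos (d : BinTree) : 1 ≤ d.size := by cases d <;> simp [size]

end BinTree

/-! ### Programs that move, copy, exchange and remove trees. -/

namespace Prog

theorem Runs.congr {P : Prog} {S S' S'' : Store} {t : ℕ} (h : Runs P S S' t) (e : S' = S'') :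
    Runs P S S'' t := e ▸ h

/-- The store which is empty but for the value stack and two of the auxiliary stacks. -/
def store (v a b : List Γ') : Store
  | .val => v
  | .aux => a
  | .buf => b
  | _ => []

@[simp] theorem store_val (v a b : List Γ') : store v a b .val = v := rfl
@[simp] theorem store_aux (v a b : List Γ') : store v a b .aux = a := rfl
@[simp] theorem store_buf (v a b : List Γ') : store v a b .buf = b := rfl
@[simp] theorem store_cnt (v a b : List Γ') : store v a b .cnt = [] := rfl

@[simp] theorem update_store_val (v a b w : List Γ') :
    Function.update (store v a b) .val w = store w a b := by
  funext k; cases k <;> rfl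

@[simp] theorem update_store_aux (v a b w : List Γ') :
    Function.update (store v a b) .aux w = store v w b := by
  funext k; cases k <;> rfl

@[simp] theorem update_store_buf (v a b w : List Γ') :
    Function.update (store v a b) .buf w = store v a w := by
  funext k; cases k <;> rfl

/-- Move one symbol. -/
def moveTop (j k : Stk) : Prog := seq (push k j (·.getD Γ'.blank)) (pop j)

theorem runs_moveTop {j k : Stk} (hjk : j ≠ k) {S : Store} {x : Γ'} {l : List Γ'}
    (h : S j = x :: l) :
    Runs (moveTop j k) S (Function.update (Function.update S j l) k (x :: S k)) 2 := by
  refine (Runs.seq (.push le_rfl) (.pop le_rfl) le_rfl).congr ?_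
  funext i
  simp only [Function.update_apply]
  split_ifs <;> simp_all

/-- Move a stack to another one, in reverse. -/
def moveAll (j k : Stk) : Prog := loop j Option.isSome (moveTop j k)

theorem runs_moveAll {j k : Stk} (hjk : j ≠ k) (l : List Γ') (S : Store) (h : S j = l) :
    Runs (moveAll j k) S (Function.update (Function.update S j []) k (l.reverse ++ S k))
      (3 * l.length + 1) := by
  induction l generalizing S with
  | nil =>
    refine (Runs.loop_done (by simp [h]) (by simp)).congr ?_
    funext i
    simp only [Function.update_apply]
    split_ifs <;> simp_all
  | cons x l ih =>
    refine (Runs.loop_step (by simp [h]) (runs_moveTop hjk h) (ih _ ?_)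
      (by simp only [List.length_cons]; omega)).congr ?_
    · simp [hjk]
    · funext i
      simp only [Function.update_apply]
      split_ifs <;> simp_all

/-- Move a stack to two others, in reverse. -/
def moveAll₂ (j k₁ k₂ : Stk) : Prog :=
  loop j Option.isSome (seq (push k₁ j (·.getD Γ'.blank)) (moveTop j k₂))

theorem runs_moveAll₂ {j k₁ k₂ : Stk} (h₁ : j ≠ k₁) (h₂ : j ≠ k₂) (h₁₂ : k₁ ≠ k₂) (l : List Γ')
    (S : Store) (h : S j = l) :
    Runs (moveAll₂ j k₁ k₂) S (Function.update (Function.update (Function.update S j []) k₁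
      (l.reverse ++ S k₁)) k₂ (l.reverse ++ S k₂)) (4 * l.length + 1) := by
  induction l generalizing S with
  | nil =>
    refine (Runs.loop_done (by simp [h]) (by simp)).congr ?_
    funext i
    simp only [Function.update_apply]
    split_ifs <;> simp_all
  | cons x l ih =>
    refine (Runs.loop_step (by simp [h]) (Runs.seq (.push le_rfl) (runs_moveTop (x := x) (l := l)
      h₂ ?_) le_rfl) (ih _ ?_) (by simp only [List.length_cons]; omega)).congr ?_
    · simp [h₁, h]
    · simp [Function.update_apply, h₂]
    · funext i
      simp only [Function.update_apply]
      split_ifs <;> simp_all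

/-- The loop that moves as many trees from the value stack as the counter tells. -/
def moveTrees (j : Stk) : Prog :=
  loop .cnt Option.isSome (ite .val (· == some Γ'.ket)
    (seq (moveTop .val j) (push .cnt .cnt fun _ => Γ'.blank)) (seq (moveTop .val j) (pop .cnt)))

/-- The counter holds the number of trees still to be moved: a leaf completes one tree, and an inner
node replaces one pending tree by two. The list of trees may grow, so the induction is on a bound
`n` for the total number of nodes. Each node costs five steps: two tests, two for the move and one
for the counter. -/
theorem runs_moveTrees {j : Stk} (h₁ : j ≠ .val) (h₂ : j ≠ .cnt) (n : ℕ) (ts : List BinTree)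
    (hn : (ts.map BinTree.size).sum ≤ n) (w : List Γ') (S : Store)
    (hv : S .val = ts.flatMap BinTree.code ++ w)
    (hc : S .cnt = List.replicate ts.length Γ'.blank) :
    Runs (moveTrees j) S (Function.update (Function.update (Function.update S .cnt []) .val w) j
      ((ts.flatMap BinTree.code).reverse ++ S j)) (5 * n + 1) := by
  induction n generalizing ts S with
  | zero =>
    cases ts with
    | nil =>
      refine (Runs.loop_done (by simp [hc]) (by simp)).congr ?_
      funext i
      simp only [Function.update_apply]
      split_ifs <;> simp_all
    | cons d ts =>
      have := d.size_pos
      simp at hn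
      omega
  | succ n ih =>
    cases ts with
    | nil =>
      refine (Runs.loop_done (by simp [hc]) (by simp)).congr ?_
      funext i
      simp only [Function.update_apply]
      split_ifs <;> simp_all
    | cons d ts =>
      cases d with
      | leaf a =>
        simp only [List.flatMap_cons, BinTree.code, List.cons_append, List.nil_append] at hv
        refine (Runs.loop_step (by simp [hc, List.replicate_succ]) (Runs.ite_false ?_ (Runs.seq
          (runs_moveTop h₁.symm hv) (.pop le_rfl) le_rfl) le_rfl)
          (ih ts ?_ _ ?_ ?_) (by omega)).congr ?_
        · simp [hv, a.toΓ'_ne_ket]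
        · simp [BinTree.size] at hn; omega
        · simp [Function.update_apply, h₁.symm]
        · simp [h₂.symm, hc, List.replicate_succ]
        · funext i
          simp only [Function.update_apply]
          split_ifs <;> simp_all [BinTree.code]
      | node l r =>
        simp only [List.flatMap_cons, BinTree.code, List.cons_append, List.append_assoc] at hv
        refine (Runs.loop_step (by simp [hc, List.replicate_succ]) (Runs.ite_true ?_ (Runs.seq
          (runs_moveTop h₁.symm hv) (.push le_rfl) le_rfl) le_rfl)
          (ih (l :: r :: ts) ?_ _ ?_ ?_) (by omega)).congr ?_
        · simp [hv]
        · simp [BinTree.size] at hn ⊢; omega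
        · simp [Function.update_apply, h₁.symm]
        · simp [h₂.symm, hc, List.replicate_succ]
        · funext i
          simp only [Function.update_apply]
          split_ifs <;> simp_all [BinTree.code]

/-- Move one tree from the value stack, in reverse. -/
def moveTree (j : Stk) : Prog := seq (push .cnt .cnt fun _ => Γ'.blank) (moveTrees j)

theorem runs_moveTree_aux (d : BinTree) (w a b : List Γ') :
    Runs (moveTree .aux) (store (d.code ++ w) a b) (store w (d.code.reverse ++ a) b)
      (5 * d.size + 2) := by
  refine (Runs.seq (.push le_rfl) (runs_moveTrees (by simp) (by simp) d.size [d] (by simp) w _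
    (by simp) (by simp)) (by omega)).congr ?_
  funext i
  cases i <;> simp [store]

theorem runs_moveTree_buf (d : BinTree) (w a b : List Γ') :
    Runs (moveTree .buf) (store (d.code ++ w) a b) (store w a (d.code.reverse ++ b))
      (5 * d.size + 2) := by
  refine (Runs.seq (.push le_rfl) (runs_moveTrees (by simp) (by simp) d.size [d] (by simp) w _
    (by simp) (by simp)) (by omega)).congr ?_
  funext i
  cases i <;> simp [store]

/-- Copy the tree on top of the value stack. -/
def dup : Prog := seq (moveTree .aux) (seq (moveAll₂ .aux .val .buf)
  (seq (moveAll .buf .aux) (moveAll .aux .val)))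

/-- Every move reverses a word, so both copies have to make an even number of moves: one returns
directly from `aux`, the other one goes through `buf` and `aux` again. -/
theorem runs_dup (d : BinTree) (w : List Γ') :
    Runs dup (store (d.code ++ w) [] []) (store (d.code ++ (d.code ++ w)) [] [])
      (15 * d.size + 5) := by
  have h := d.length_code
  refine (Runs.seq (runs_moveTree_aux d w [] []) (Runs.seq (runs_moveAll₂ (by simp) (by simp)
    (by simp) d.code.reverse _ (by simp)) (Runs.seq (runs_moveAll (by simp) d.code _ (by simp))
    (runs_moveAll (by simp) d.code.reverse _ (by simp)) le_rfl) le_rfl) ?_).congr ?_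
  · simp [h]; omega
  · simp

/-- Exchange the two trees on top of the value stack. -/
def swap : Prog := seq (moveTree .aux) (seq (moveTree .buf)
  (seq (moveAll .aux .val) (moveAll .buf .val)))

theorem runs_swap (d e : BinTree) (w : List Γ') :
    Runs swap (store (d.code ++ (e.code ++ w)) [] []) (store (e.code ++ (d.code ++ w)) [] [])
      (8 * d.size + 8 * e.size + 6) := by
  have h := d.length_code
  have h' := e.length_code
  refine (Runs.seq (runs_moveTree_aux d _ [] []) (Runs.seq (runs_moveTree_buf e _ _ _)
    (Runs.seq (runs_moveAll (by simp) d.code.reverse _ (by simp))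
    (runs_moveAll (by simp) e.code.reverse _ (by simp)) le_rfl) le_rfl) ?_).congr ?_
  · simp [h, h']; omega
  · simp

/-- Put the second one of the three trees on top of the value stack below the others. -/
def bury : Prog := seq (moveTree .buf) (seq (moveTree .aux) (seq (moveTree .buf)
  (seq (moveAll .aux .val) (moveAll .buf .val))))

theorem runs_bury (d e f : BinTree) (w : List Γ') :
    Runs bury (store (d.code ++ (e.code ++ (f.code ++ w))) [] [])
      (store (d.code ++ (f.code ++ (e.code ++ w))) [] [])
      (8 * d.size + 8 * e.size + 8 * f.size + 8) := by
  have h := d.length_code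
  have h' := e.length_code
  have h'' := f.length_code
  refine (Runs.seq (runs_moveTree_buf d _ [] []) (Runs.seq (runs_moveTree_aux e _ _ _)
    (Runs.seq (runs_moveTree_buf f _ _ _)
    (Runs.seq (runs_moveAll (by simp) e.code.reverse _ (by simp))
    (runs_moveAll (by simp) (f.code.reverse ++ d.code.reverse) _ (by simp)) le_rfl) le_rfl)
      le_rfl) ?_).congr ?_
  · simp [h, h', h'']; omega
  · simp

/-- Remove the tree on top of the value stack. -/
def drop : Prog := seq (moveTree .aux) (loop .aux Option.isSome (pop .aux))

theorem runs_clear (l w b : List Γ') :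
    Runs (loop .aux Option.isSome (pop .aux)) (store w l b) (store w [] b) (2 * l.length + 1) := by
  induction l with
  | nil => exact .loop_done (by simp) (by simp)
  | cons x l ih =>
    refine Runs.loop_step (by simp) (.pop le_rfl) ?_
      (show 1 + (2 * l.length + 1) + 1 ≤ _ by simp only [List.length_cons]; omega)
    simpa using ih

theorem runs_drop (d : BinTree) (w : List Γ') :
    Runs drop (store (d.code ++ w) [] []) (store w [] []) (7 * d.size + 3) := by
  refine Runs.seq (runs_moveTree_aux d w [] []) (runs_clear _ _ _) ?_
  simp [d.length_code]; omega

end Prog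

/-! ### Functions that are computable in polynomial time -/

/-- Types whose elements are coded by trees. -/
class TreeCode (α : Type) where
  /-- the tree that codes an element -/
  enc : α → BinTree

open TreeCode

/-- The size of the code of an element. -/
def tsize {α : Type} [TreeCode α] (a : α) : ℕ := (enc a).size

instance : TreeCode LeafSym := ⟨.leaf⟩

instance : TreeCode Bool := ⟨fun b => .leaf (.bit b)⟩

instance {α β : Type} [TreeCode α] [TreeCode β] : TreeCode (α × β) :=
  ⟨fun a => .node (enc a.1) (enc a.2)⟩

/-- The code of a list. -/
def encList {α : Type} [TreeCode α] : List α → BinTree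
  | [] => .leaf .nil
  | a :: l => .node (enc a) (encList l)

instance {α : Type} [TreeCode α] : TreeCode (List α) := ⟨encList⟩

section

variable {α β γ δ : Type} [TreeCode α] [TreeCode β] [TreeCode γ] [TreeCode δ]

theorem tsize_pos (a : α) : 1 ≤ tsize a := BinTree.size_pos _

@[simp] theorem tsize_sym (a : LeafSym) : tsize a = 1 := rfl

@[simp] theorem tsize_bool (b : Bool) : tsize b = 1 := rfl

@[simp] theorem tsize_pair (a : α) (b : β) : tsize (a, b) = tsize a + tsize b + 1 := rfl

theorem tsize_prod (p : α × β) : tsize p = tsize p.1 + tsize p.2 + 1 := rfl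

@[simp] theorem tsize_nil : tsize ([] : List α) = 1 := rfl

@[simp] theorem tsize_cons (a : α) (l : List α) : tsize (a :: l) = tsize a + tsize l + 1 := rfl

theorem tsize_append (l l' : List α) : tsize (l ++ l') + 1 = tsize l + tsize l' := by
  induction l with
  | nil => simp; omega
  | cons a l ih => simp; omega

theorem length_lt_tsize (l : List α) : l.length < tsize l := by
  induction l with
  | nil => simp
  | cons a l ih => simp; omega

theorem tsize_le_of_mem {a : α} {l : List α} (h : a ∈ l) : tsize a ≤ tsize l := by
  induction l with
  | nil => simp at h
  | cons b l ih =>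
    rcases List.mem_cons.1 h with rfl | h
    · simp; omega
    · have := ih h; simp; omega

theorem tsize_le_of_forall {l : List α} {n B : ℕ} (hl : l.length ≤ n) (h : ∀ a ∈ l, tsize a ≤ B) :
    tsize l ≤ n * (B + 1) + 1 := by
  induction l generalizing n with
  | nil => simp
  | cons a l ih =>
    obtain _ | n := n
    · simp at hl
    have h₁ := h a (by simp)
    have h₂ := ih (n := n) (by simpa using hl) fun b hb => h b (by simp [hb])
    simp only [tsize_cons, add_mul]
    omega

theorem tsize_reverse (l : List α) : tsize l.reverse = tsize l := by
  induction l with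
  | nil => rfl
  | cons a l ih => have := tsize_append l.reverse [a]; simp at this ⊢; omega

theorem tsize_suffix {l l' : List α} (h : l <:+ l') : tsize l ≤ tsize l' := by
  obtain ⟨r, rfl⟩ := h
  have := tsize_append r l
  have := tsize_pos r
  omega

theorem tsize_prefix {l l' : List α} (h : l <+: l') : tsize l ≤ tsize l' := by
  obtain ⟨r, rfl⟩ := h
  have := tsize_append l r
  have := tsize_pos r
  omega

end

theorem Polynomial.eval_mono_nat (p : Polynomial ℕ) {m n : ℕ} (h : m ≤ n) :
    p.eval m ≤ p.eval n := by
  simp only [Polynomial.eval_eq_sum, Polynomial.sum]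
  gcongr

open Prog in
/-- `PolyTime f`: some program replaces the code of `a` on top of the value stack by the code of
`f a`, in polynomial time. -/
@[fun_prop]
def PolyTime {α β : Type} [TreeCode α] [TreeCode β] (f : α → β) : Prop :=
  ∃ (P : Prog) (p : Polynomial ℕ), ∀ a,
    (∀ w, Runs P (store ((enc a).code ++ w) [] []) (store ((enc (f a)).code ++ w) [] [])
      (p.eval (tsize a))) ∧ tsize (f a) ≤ p.eval (tsize a)

/-! ### Closure properties of polynomial-time functions. -/

namespace PolyTime

open Prog

variable {α β γ δ : Type} [TreeCode α] [TreeCode β] [TreeCode γ] [TreeCode δ]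

theorem of_eq {f g : α → β} (hf : PolyTime f) (h : ∀ a, f a = g a) : PolyTime g :=
  (funext h : f = g) ▸ hf

theorem size_le {f : α → β} (hf : PolyTime f) :
    ∃ p : Polynomial ℕ, ∀ a, tsize (f a) ≤ p.eval (tsize a) := by
  obtain ⟨P, p, h⟩ := hf
  exact ⟨p, fun a => (h a).2⟩

/-- A function that does not change the code. -/
theorem of_enc_eq {f : α → β} (h : ∀ a, enc (f a) = enc a) : PolyTime f := by
  -- A push followed by a pop serves as the empty program.
  refine ⟨seq (push .val .val fun _ => Γ'.blank) (pop .val), Polynomial.X + 2, fun a =>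
    ⟨fun w => ?_, ?_⟩⟩
  · refine (Runs.seq (.push le_rfl) (.pop le_rfl) ?_).congr ?_
    · simp
    · simp [h]
  · simp [tsize, h]

@[fun_prop]
theorem id : PolyTime fun a : α => a := of_enc_eq fun _ => rfl

-- The size bound in the definition of `PolyTime` is used here: it makes the time of the second
-- program polynomial in the size of the original argument.
@[fun_prop]
theorem comp {g : β → γ} {f : α → β} (hg : PolyTime g) (hf : PolyTime f) :
    PolyTime fun a => g (f a) := by
  obtain ⟨P, p, hp⟩ := hf
  obtain ⟨Q, q, hq⟩ := hg
  refine ⟨seq P Q, p + q.comp p, fun a => ?_⟩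
  have h : q.eval (tsize (f a)) ≤ q.eval (p.eval (tsize a)) := q.eval_mono_nat (hp a).2
  refine ⟨fun w => Runs.seq ((hp a).1 w) ((hq (f a)).1 w) ?_, ((hq (f a)).2.trans h).trans ?_⟩ <;>
    simp [h]

/-- The program that writes a word on the value stack. -/
def write : List Γ' → Prog
  | [] => seq (push .val .val fun _ => Γ'.blank) (pop .val)
  | x :: l => seq (write l) (push .val .val fun _ => x)

theorem runs_write (l w : List Γ') :
    Runs (write l) (store w [] []) (store (l ++ w) [] []) (l.length + 2) := by
  induction l with
  | nil =>
    refine (Runs.seq (.push le_rfl) (.pop le_rfl) ?_).congr ?_ <;> simp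
  | cons x l ih =>
    refine (Runs.seq ih (.push le_rfl) ?_).congr ?_
    · simp
    · simp

@[fun_prop]
theorem const (b : β) : PolyTime fun _ : α => b := by
  refine ⟨seq drop (write (enc b).code), 7 * Polynomial.X + Polynomial.C (5 + tsize b), fun a =>
    ⟨fun w => Runs.seq (runs_drop _ _) (runs_write _ _) ?_, ?_⟩⟩
  · simp [BinTree.length_code, tsize]; omega
  · simp; omega

@[fun_prop]
theorem pair {f : α → β} {g : α → γ} (hf : PolyTime f) (hg : PolyTime g) :
    PolyTime fun a => (f a, g a) := by
  obtain ⟨P, p, hp⟩ := hf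
  obtain ⟨Q, q, hq⟩ := hg
  refine ⟨seq dup (seq Q (seq swap (seq P (push .val .val fun _ => Γ'.ket)))),
    23 * Polynomial.X + p + 9 * q + 12, fun a => ⟨fun w => ?_, ?_⟩⟩
  · refine (Runs.seq (runs_dup (enc a) w) (Runs.seq ((hq a).1 _) (Runs.seq (runs_swap _ _ _)
      (Runs.seq ((hp a).1 _) (.push le_rfl) le_rfl) le_rfl) le_rfl) ?_).congr ?_
    · have := (hq a).2
      simp [tsize] at this ⊢
      omega
    · simp [enc, BinTree.code]
  · have h₁ := (hq a).2
    have h₂ := (hp a).2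
    simp
    omega

theorem fst' : PolyTime fun a : α × β => a.1 := by
  refine ⟨seq (pop .val) (seq swap drop), 100 * Polynomial.X + 10, fun a => ⟨fun w => ?_, ?_⟩⟩
  · refine Runs.seq (.pop le_rfl) (Runs.seq (S₁ := store ((enc a.2).code ++ ((enc a.1).code ++ w))
      [] []) (t₁ := 8 * tsize a.1 + 8 * tsize a.2 + 6) ?_ (runs_drop _ _) le_rfl) ?_
    · refine Eq.subst (motive := fun S => Runs swap S _ _) ?_ (runs_swap (enc a.1) (enc a.2) w)
      simp [enc, BinTree.code]
    · have h₁ := tsize_prod a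
      have h₂ : (enc a.2).size = tsize a.2 := rfl
      simp
      omega
  · simp [tsize_prod]; omega

theorem snd' : PolyTime fun a : α × β => a.2 := by
  refine ⟨seq (pop .val) drop, 100 * Polynomial.X + 10, fun a => ⟨fun w => ?_, ?_⟩⟩
  · refine Runs.seq (.pop le_rfl) (t₂ := 7 * tsize a.1 + 3) ?_ ?_
    · refine Eq.subst (motive := fun S => Runs drop S _ _) ?_ (runs_drop (enc a.1) _)
      simp [enc, BinTree.code]
    · simp [tsize_prod]; omega
  · simp [tsize_prod]; omega

@[fun_prop]
theorem fst {f : α → β × γ} (hf : PolyTime f) : PolyTime fun a => (f a).1 := fst'.comp hf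

@[fun_prop]
theorem snd {f : α → β × γ} (hf : PolyTime f) : PolyTime fun a => (f a).2 := snd'.comp hf

-- A nonempty list has the same code as the pair of its head and its tail.
@[fun_prop]
theorem cons {f : α → β} {g : α → List β} (hf : PolyTime f) (hg : PolyTime g) :
    PolyTime fun a => f a :: g a :=
  (of_enc_eq (f := fun p : β × List β => p.1 :: p.2) fun _ => rfl).comp (hf.pair hg)

theorem cond {c : α → Bool} {f g : α → β} (hc : PolyTime c) (hf : PolyTime f) (hg : PolyTime g) :
    PolyTime fun a => bif c a then f a else g a := by
  obtain ⟨R, r, hr⟩ := hc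
  obtain ⟨P, p, hp⟩ := hf
  obtain ⟨Q, q, hq⟩ := hg
  refine ⟨seq dup (seq R (ite .val (· == some (Γ'.bit true)) (seq (pop .val) P)
    (seq (pop .val) Q))), 15 * Polynomial.X + p + q + r + 7, fun a => ⟨fun w => ?_, ?_⟩⟩
  · refine Runs.seq (runs_dup (enc a) w) (Runs.seq ((hr a).1 _)
      (t₂ := 2 + p.eval (tsize a) + q.eval (tsize a)) ?_ le_rfl) ?_
    · cases h : c a
      · refine Runs.ite_false (by simp [enc, BinTree.code, LeafSym.toΓ']) (Runs.seq (.pop le_rfl)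
          (t₂ := q.eval (tsize a)) ?_ le_rfl) (by omega)
        simpa [enc, BinTree.code, h] using (hq a).1 w
      · refine Runs.ite_true (by simp [enc, BinTree.code, LeafSym.toΓ']) (Runs.seq (.pop le_rfl)
          (t₂ := p.eval (tsize a)) ?_ le_rfl) (by omega)
        simpa [enc, BinTree.code, h] using (hp a).1 w
    · simp [tsize]; omega
  · have h₁ := (hq a).2
    have h₂ := (hp a).2
    cases h : c a <;> simp [h] <;> omega

/-- The top symbol of the list tells which case applies. In the nonempty case the code of `x :: l`
is also that of `(x, l)`. Once `a` has been brought above it, one more `ket` completes the code of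
`(a, x, l)`, the argument of `g`. -/
theorem listCases {L : α → List β} {f : α → γ} {g : α → β → List β → γ} (hL : PolyTime L)
    (hf : PolyTime f) (hg : PolyTime fun p : α × β × List β => g p.1 p.2.1 p.2.2) :
    PolyTime fun a => match L a with
      | [] => f a
      | x :: l => g a x l := by
  obtain ⟨R, r, hr⟩ := hL
  obtain ⟨P, p, hp⟩ := hf
  obtain ⟨Q, q, hq⟩ := hg
  refine ⟨seq dup (seq R (ite .val (· == some Γ'.ket)
    (seq swap (seq (push .val .val fun _ => Γ'.ket) Q)) (seq (pop .val) P))),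
    23 * Polynomial.X + p + q.comp (Polynomial.X + r + 1) + 9 * r + 100, fun a => ?_⟩
  cases h : L a with
  | nil =>
    refine ⟨fun w => Runs.seq (runs_dup (enc a) w) (Runs.seq ((hr a).1 _) (Runs.ite_false ?_
      (Runs.seq (.pop le_rfl) (t₂ := p.eval (tsize a)) ?_ le_rfl) le_rfl) le_rfl) ?_, ?_⟩
    · simp [h, enc, encList, BinTree.code, LeafSym.toΓ']
    · simpa [h, enc, encList, BinTree.code] using (hp a).1 w
    · simp [tsize]; omega
    · have := (hp a).2
      simp [h]; omega
  | cons x l =>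
    have h₁ : tsize (x :: l) ≤ _ := h ▸ (hr a).2
    have h₂ := hq (a, x, l)
    have h₃ : q.eval (tsize (a, x, l)) ≤ q.eval (tsize a + r.eval (tsize a) + 1) := by
      apply Polynomial.eval_mono_nat
      simp at h₁ ⊢
      omega
    refine ⟨fun w => Runs.seq (runs_dup (enc a) w) (Runs.seq ((hr a).1 _) (Runs.ite_true ?_
      (Runs.seq (runs_swap _ _ _)
        (Runs.seq (.push le_rfl) (t₂ := q.eval (tsize (a, x, l))) ?_ le_rfl) le_rfl) le_rfl)
        le_rfl) ?_, ?_⟩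
    · simp [h, enc, encList, BinTree.code]
    · simpa [h, enc, encList, BinTree.code] using h₂.1 w
    · simp only [tsize] at h₁ h₃ ⊢
      simp [h] at h₁ ⊢
      omega
    · have := h₂.2
      simp [h] at h₃ this ⊢
      omega

theorem eq_sym (c : LeafSym) : PolyTime fun a : LeafSym => decide (a = c) := by
  refine ⟨ite .val (· == some c.toΓ') (seq (pop .val) (push .val .val fun _ => Γ'.bit true))
    (seq (pop .val) (push .val .val fun _ => Γ'.bit false)), 3, fun a => ⟨fun w => ?_, ?_⟩⟩
  · by_cases h : a = c
    · refine (Runs.ite_true (by simp [enc, BinTree.code, h]) (Runs.seq (.pop le_rfl) (.push le_rfl)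
        le_rfl) (by simp)).congr ?_
      simp [enc, BinTree.code, LeafSym.toΓ', h]
    · have h' : a.toΓ' ≠ c.toΓ' := by
        intro e
        apply h
        cases a <;> cases c <;> simp_all [LeafSym.toΓ']
      refine (Runs.ite_false (by simp [enc, BinTree.code, h']) (Runs.seq (.pop le_rfl)
        (.push le_rfl) le_rfl) (by simp)).congr ?_
      simp [enc, BinTree.code, LeafSym.toΓ', h]
  · simp

/-- The loop that folds a list. -/
def foldLoop (P : Prog) : Prog :=
  loop .val (· == some Γ'.ket) (seq (pop .val) (seq bury
    (seq (push .val .val fun _ => Γ'.ket) (seq P swap))))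

/-- Before each round the stack holds the remaining list above the pair of parameter and state.
Popping `ket` exposes the head, `bury` moves the rest of the list out of the way, and a new `ket`
joins the head to parameter and state. The bound `B` on all intermediate states is a genuine
hypothesis: a polynomial-time step, when iterated, may double the state each time. -/
theorem runs_foldLoop {P : Prog} {p : Polynomial ℕ} {g : α → γ → β → γ}
    (hP : ∀ x : β × α × γ, (∀ w, Runs P (store ((enc x).code ++ w) [] [])
      (store ((enc (x.2.1, g x.2.1 x.2.2 x.1)).code ++ w) [] []) (p.eval (tsize x))))
    (a : α) (l : List β) (s : γ) (N B : ℕ) (ha : tsize a ≤ N) (hl : tsize l ≤ N)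
    (hB : ∀ l', l' <+: l → tsize (l'.foldl (g a) s) ≤ B) (w : List Γ') :
    Runs (foldLoop P) (store ((enc l).code ++ ((enc (a, s)).code ++ w)) [] [])
      (store ((enc ([] : List β)).code ++ ((enc (a, l.foldl (g a) s)).code ++ w)) [] [])
      (l.length * (32 * (2 * N + B + 2) + 17 + p.eval (2 * N + B + 2)) + 1) := by
  induction l generalizing s with
  | nil => exact .loop_done (by simp [enc, encList, BinTree.code, LeafSym.toΓ']) (by simp)
  | cons x l ih =>
    have h₀ := hB [] (by simp)
    have h₁ := hB [x] (by simp)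
    simp only [List.foldl_nil, List.foldl_cons, tsize_cons] at h₀ h₁ hl
    have h₂ : p.eval (tsize (x, a, s)) ≤ p.eval (2 * N + B + 2) := by
      apply Polynomial.eval_mono_nat
      simp
      omega
    refine Runs.loop_step (by simp [enc, encList, BinTree.code]) ?_ (ih (g a s x) (by omega)
      fun l' hl' => hB (x :: l') (by simpa using hl')) (t₁ := 32 * (2 * N + B + 2) + 16 +
        p.eval (2 * N + B + 2)) ?_
    · refine Runs.seq (S₁ := store ((enc x).code ++ ((enc l).code ++ ((enc (a, s)).code ++ w)))
        [] []) (t₁ := 1) ?_ (Runs.seq (runs_bury _ _ _ _) (Runs.seq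
          (S₁ := store ((enc (x, a, s)).code ++ ((enc l).code ++ w)) [] []) (t₁ := 1) ?_
          (Runs.seq (hP _ _) (runs_swap _ _ _) le_rfl) le_rfl) le_rfl) ?_
      · refine (Runs.pop le_rfl).congr ?_
        simp [enc, encList, BinTree.code]
      · refine (Runs.push le_rfl).congr ?_
        simp [enc, BinTree.code]
      · have e₁ : (enc (a, s)).size = tsize a + tsize s + 1 := rfl
        have e₂ : (enc (a, g a s x)).size = tsize a + tsize (g a s x) + 1 := rfl
        have e₃ : (enc x).size = tsize x := rfl
        have e₄ : (enc l).size = tsize l := rfl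
        simp only [e₁, e₂, e₃, e₄]
        omega
    · simp only [List.length_cons, add_mul]
      omega

/-- A bounded iteration along a list. -/
theorem foldl {L : α → List β} {i : α → γ} {g : α → γ → β → γ} (hL : PolyTime L)
    (hi : PolyTime i) (hg : PolyTime fun p : α × γ × β => g p.1 p.2.1 p.2.2)
    (hb : ∃ q : Polynomial ℕ, ∀ a l, l <+: L a → tsize (l.foldl (g a) (i a)) ≤ q.eval (tsize a)) :
    PolyTime fun a => (L a).foldl (g a) (i a) := by
  have h₁ : PolyTime fun a => (L a, (a, i a)) := hL.pair (id.pair hi)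
  have h₂ : PolyTime fun x : β × α × γ => (x.2.1, g x.2.1 x.2.2 x.1) :=
    (fst (snd id)).pair (hg.comp ((fst (snd id)).pair ((snd (snd id)).pair (fst id))))
  -- Each step needs the parameter `a` again, so the loop keeps it beside the state.
  suffices h : PolyTime fun a => (a, (L a).foldl (g a) (i a)) from snd h
  obtain ⟨P, p, hp⟩ := h₁
  obtain ⟨Q, r, hr⟩ := h₂
  obtain ⟨q, hq⟩ := hb
  refine ⟨seq P (seq (pop .val) (seq (foldLoop Q) (pop .val))),
    p + 1 + p * (32 * (2 * p + q + 2) + 17 + r.comp (2 * p + q + 2)) + 2 + Polynomial.X + q,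
      fun a => ⟨fun w => ?_, ?_⟩⟩
  · have h₁ := (hp a).2
    simp only [tsize_pair] at h₁
    have h₂ := length_lt_tsize (L a)
    refine (Runs.seq ((hp a).1 w) (Runs.seq (S₁ := store ((enc (L a)).code ++
      ((enc (a, i a)).code ++ w)) [] []) (t₁ := 1) ?_ (Runs.seq (runs_foldLoop (fun x => (hr x).1)
        a (L a) (i a) (p.eval (tsize a)) (q.eval (tsize a)) (by omega) (by omega) (hq a) w)
        (.pop le_rfl) le_rfl) le_rfl) ?_).congr ?_
    · refine (Runs.pop le_rfl).congr ?_
      simp [enc, BinTree.code]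
    · have h₃ : (L a).length * (32 * (2 * p.eval (tsize a) + q.eval (tsize a) + 2) + 17 +
          r.eval (2 * p.eval (tsize a) + q.eval (tsize a) + 2)) ≤ p.eval (tsize a) *
          (32 * (2 * p.eval (tsize a) + q.eval (tsize a) + 2) + 17 +
          r.eval (2 * p.eval (tsize a) + q.eval (tsize a) + 2)) :=
        Nat.mul_le_mul_right _ (by omega)
      simp
      omega
    · simp [enc, encList, BinTree.code]
  · have := hq a (L a) List.prefix_rfl
    simp
    omega

end PolyTime

/-! ### Boolean and list functions in polynomial time. -/

namespace PolyTime

variable {α β γ δ : Type} [TreeCode α] [TreeCode β] [TreeCode γ] [TreeCode δ]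

attribute [fun_prop] cond

@[fun_prop]
theorem not {f : α → Bool} (hf : PolyTime f) : PolyTime fun a => !(f a) :=
  (hf.cond (const false) (const true)).of_eq fun a => by cases f a <;> rfl

@[fun_prop]
theorem and {f g : α → Bool} (hf : PolyTime f) (hg : PolyTime g) :
    PolyTime fun a => f a && g a :=
  (hf.cond hg (const false)).of_eq fun a => by cases f a <;> rfl

@[fun_prop]
theorem or {f g : α → Bool} (hf : PolyTime f) (hg : PolyTime g) :
    PolyTime fun a => f a || g a :=
  (hf.cond (const true) hg).of_eq fun a => by cases f a <;> rfl

@[fun_prop]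
theorem isEmpty {f : α → List β} (hf : PolyTime f) : PolyTime fun a => (f a).isEmpty :=
  (hf.listCases (const true) (g := fun _ _ _ => false) (const false)).of_eq fun a => by
    cases f a <;> rfl

@[fun_prop]
theorem tail {f : α → List β} (hf : PolyTime f) : PolyTime fun a => (f a).tail :=
  (hf.listCases (const []) (g := fun _ _ l => l) (by fun_prop)).of_eq fun a => by
    cases f a <;> rfl

@[fun_prop]
theorem headD {f : α → List β} {g : α → β} (hf : PolyTime f) (hg : PolyTime g) :
    PolyTime fun a => (f a).headD (g a) :=
  (hf.listCases hg (g := fun _ x _ => x) (by fun_prop)).of_eq fun a => by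
    cases f a <;> rfl

@[fun_prop]
theorem reverse {f : α → List β} (hf : PolyTime f) : PolyTime fun a => (f a).reverse := by
  have key : ∀ l l' : List β, l.foldl (fun s x => x :: s) l' = l.reverse ++ l' := by
    intro l
    induction l with
    | nil => simp
    | cons x l ih => intro l'; simp [ih]
  obtain ⟨p, hp⟩ := hf.size_le
  refine (foldl hf (const []) (g := fun _ s x => x :: s) (by fun_prop) ⟨p, ?_⟩).of_eq fun a => by
    simp [key]
  intro a l hl
  simpa [key, tsize_reverse] using (tsize_prefix hl).trans (hp a)

/-- A bounded recursion along a list. -/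
theorem foldr {L : α → List β} {i : α → γ} {g : α → β → γ → γ} (hL : PolyTime L)
    (hi : PolyTime i) (hg : PolyTime fun p : α × β × γ => g p.1 p.2.1 p.2.2)
    (hb : ∃ q : Polynomial ℕ, ∀ a l, l <:+ L a → tsize (l.foldr (g a) (i a)) ≤ q.eval (tsize a)) :
    PolyTime fun a => (L a).foldr (g a) (i a) := by
  obtain ⟨q, hq⟩ := hb
  refine (foldl hL.reverse hi (g := fun a s x => g a x s) (hg.comp (f := fun p : α × γ × β =>
    (p.1, p.2.2, p.2.1)) (by fun_prop)) ⟨q, fun a l hl => ?_⟩).of_eq fun a => by simp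
  rw [List.foldl_eq_foldr_reverse]
  exact hq a _ (by simpa using List.reverse_suffix.2 hl)

@[fun_prop]
theorem append {f g : α → List β} (hf : PolyTime f) (hg : PolyTime g) :
    PolyTime fun a => f a ++ g a := by
  obtain ⟨p, hp⟩ := hf.size_le
  obtain ⟨q, hq⟩ := hg.size_le
  refine (foldr hf hg (g := fun _ x s => x :: s) (by fun_prop) ⟨p + q, ?_⟩).of_eq fun a => by simp
  intro a l hl
  have h₁ := (tsize_suffix hl).trans (hp a)
  have h₂ := hq a
  have h₃ := tsize_append l (g a)
  simp
  omega

@[fun_prop]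
theorem flatMap {f : α → List β} {g : α → β → List γ} (hf : PolyTime f)
    (hg : PolyTime fun p : α × β => g p.1 p.2) : PolyTime fun a => (f a).flatMap (g a) := by
  obtain ⟨p, hp⟩ := hf.size_le
  obtain ⟨q, hq⟩ := hg.size_le
  have key : ∀ a (l : List β), l.foldr (fun x s => g a x ++ s) [] = l.flatMap (g a) := by
    intro a l
    induction l with
    | nil => rfl
    | cons x l ih => simp [ih]
  refine (foldr hf (const []) (g := fun a x s => g a x ++ s)
    (append (hg.comp (f := fun p : α × β × List γ => (p.1, p.2.1)) (by fun_prop)) (by fun_prop))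
      ⟨p * q.comp (Polynomial.X + p + 1) + 1, ?_⟩).of_eq fun a => key a _
  intro a l hl
  rw [key]
  have h₁ := (tsize_suffix hl).trans (hp a)
  have h₂ : ∀ l : List β, tsize l ≤ p.eval (tsize a) →
      tsize (l.flatMap (g a)) ≤ l.length * q.eval (tsize a + p.eval (tsize a) + 1) + 1 := by
    intro l hl
    induction l with
    | nil => simp
    | cons x l ih =>
      simp only [tsize_cons] at hl
      have h₃ := tsize_append (g a x) (l.flatMap (g a))
      have h₄ : tsize (g a x) ≤ q.eval (tsize (a, x)) := hq (a, x)
      have h₅ : q.eval (tsize (a, x)) ≤ q.eval (tsize a + p.eval (tsize a) + 1) :=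
        q.eval_mono_nat (by simp; omega)
      have h₆ := ih (by omega)
      simp only [List.flatMap_cons, List.length_cons, add_mul, one_mul]
      omega
  refine (h₂ l h₁).trans ?_
  have h₃ := length_lt_tsize l
  have := Nat.mul_le_mul_right (q.eval (tsize a + p.eval (tsize a) + 1))
    (show l.length ≤ p.eval (tsize a) by omega)
  simpa using this

@[fun_prop]
theorem map {f : α → List β} {g : α → β → γ} (hf : PolyTime f)
    (hg : PolyTime fun p : α × β => g p.1 p.2) : PolyTime fun a => (f a).map (g a) :=
  (flatMap hf (g := fun a x => [g a x]) (by fun_prop)).of_eq fun a => by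
    rw [← List.map_eq_flatMap]

@[fun_prop]
theorem filter {f : α → List β} {g : α → β → Bool} (hf : PolyTime f)
    (hg : PolyTime fun p : α × β => g p.1 p.2) : PolyTime fun a => (f a).filter (g a) :=
  (flatMap hf (g := fun a x => bif g a x then [x] else []) (by fun_prop)).of_eq fun a => by
    induction f a with
    | nil => rfl
    | cons x l ih => cases h : g a x <;> simp [h, ih]

@[fun_prop]
theorem all {f : α → List β} {g : α → β → Bool} (hf : PolyTime f)
    (hg : PolyTime fun p : α × β => g p.1 p.2) : PolyTime fun a => (f a).all (g a) :=
  (isEmpty (filter hf (g := fun a x => !(g a x)) (by fun_prop))).of_eq fun a => by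
    induction f a with
    | nil => rfl
    | cons x l ih => cases h : g a x <;> simp [h, ih]

@[fun_prop]
theorem dropLength {f : α → List β} {g : α → List γ} (hf : PolyTime f) (hg : PolyTime g) :
    PolyTime fun a => (f a).drop (g a).length := by
  have key : ∀ (l : List γ) (l' : List β), l.foldl (fun s _ => s.tail) l' = l'.drop l.length := by
    intro l
    induction l with
    | nil => simp
    | cons x l ih => intro l'; simp [ih]
  obtain ⟨p, hp⟩ := hf.size_le
  refine (foldl hg hf (g := fun _ s _ => s.tail) (by fun_prop) ⟨p, ?_⟩).of_eq fun a => key _ _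
  intro a l hl
  rw [key]
  exact (tsize_suffix (List.drop_suffix _ _)).trans (hp a)

theorem _root_.tsize_zip_le (l : List β) (l' : List γ) :
    tsize (l.zip l') ≤ tsize l + tsize l' := by
  induction l generalizing l' with
  | nil => simp
  | cons x l ih =>
    cases l' with
    | nil => simp
    | cons y l' => have := ih l'; simp; omega

@[fun_prop]
theorem zip {f : α → List β} {g : α → List γ} (hf : PolyTime f) (hg : PolyTime g) :
    PolyTime fun a => (f a).zip (g a) := by
  -- The state consists of the unread part of the second list and the pairs formed so far.
  let step : List γ × List (β × γ) → β → List γ × List (β × γ) := fun s x =>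
    match s.1 with
    | [] => ([], s.2)
    | y :: r => (r, s.2 ++ [(x, y)])
  have hs : PolyTime fun p : α × (List γ × List (β × γ)) × β => step p.2.1 p.2.2 :=
    listCases (L := fun p : α × (List γ × List (β × γ)) × β => p.2.1.1)
      (f := fun p => ([], p.2.1.2)) (g := fun p y r => (r, p.2.1.2 ++ [(p.2.2, y)]))
      (by fun_prop) (by fun_prop) (by fun_prop)
  have key : ∀ (l : List β) (l' : List γ) (r : List (β × γ)),
      l.foldl step (l', r) = (l'.drop l.length, r ++ l.zip l') := by
    intro l
    induction l with
    | nil => simp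
    | cons x l ih => intro l' r; cases l' <;> simp [ih, step]
  obtain ⟨p, hp⟩ := hf.size_le
  obtain ⟨q, hq⟩ := hg.size_le
  refine (snd (foldl hf (i := fun a => (g a, [])) (g := fun _ => step) (by fun_prop) hs
    ⟨p + 2 * q + 1, ?_⟩)).of_eq fun a => by simp [key]
  intro a l hl
  have h₁ := (tsize_prefix hl).trans (hp a)
  have h₂ := hq a
  have h₃ := tsize_zip_le l (g a)
  have h₄ := tsize_suffix (List.drop_suffix l.length (g a))
  simp [key]
  omega

end PolyTime

/-- Types with equality decidable in polynomial time. -/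
class PolyEq (α : Type) [TreeCode α] [DecidableEq α] : Prop where
  eq : PolyTime fun p : α × α => decide (p.1 = p.2)

namespace PolyTime

variable {α β : Type} [TreeCode α] [TreeCode β]

@[fun_prop]
theorem decideEq [DecidableEq β] [PolyEq β] {f g : α → β} (hf : PolyTime f) (hg : PolyTime g) :
    PolyTime fun a => decide (f a = g a) :=
  PolyEq.eq.comp (hf.pair hg)

instance : PolyEq Bool where
  eq := (cond (c := fun p : Bool × Bool => p.1) (f := fun p => p.2) (g := fun p => !p.2)
    (by fun_prop) (by fun_prop) (by fun_prop)).of_eq fun p => by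
      obtain ⟨_ | _, _ | _⟩ := p <;> rfl

instance [DecidableEq β] [PolyEq β] : PolyEq (List β) where
  eq := by
    -- Both remainders are empty exactly if the lengths agree; `zip` alone would ignore the surplus
    -- of the longer list.
    have h : PolyTime fun p : List β × List β => ((p.1.drop p.2.length).isEmpty &&
        (p.2.drop p.1.length).isEmpty) && (p.1.zip p.2).all fun x => decide (x.1 = x.2) := by
      fun_prop
    refine h.of_eq fun p => ?_
    obtain ⟨l, l'⟩ := p
    induction l generalizing l' with
    | nil => cases l' <;> simp
    | cons x l ih =>
      cases l' with
      | nil => simp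
      | cons y l' =>
        have := ih l'
        rw [Bool.eq_iff_iff] at this ⊢
        simp at this ⊢
        rw [← this]
        tauto

end PolyTime

/-! ### Binary arithmetic, least significant bit first -/

/-- The number that a word stands for. -/
def binVal : List Bool → ℕ
  | [] => 0
  | b :: l => b.toNat + 2 * binVal l

theorem binVal_encodeNat (n : ℕ) : binVal (encodeNat n) = n := by
  have key : ∀ p : PosNum, binVal (encodePosNum p) = p := by
    intro p
    induction p with
    | one => rfl
    | bit0 p ih => simp [encodePosNum, binVal, ih]; omega
    | bit1 p ih => simp [encodePosNum, binVal, ih]; omega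
  have h : ∀ m : Num, binVal (encodeNum m) = m := by
    intro m
    cases m with
    | zero => rfl
    | pos p => exact key p
  rw [encodeNat, h]
  simp

theorem tsize_word (l : List Bool) : tsize l = 2 * l.length + 1 := by
  induction l with
  | nil => rfl
  | cons b l ih => simp [ih]; omega

/-- The word `l`, extended by zeros to the length of `l'`, if that is larger. -/
def binPad (l l' : List Bool) : List Bool := l ++ (l'.drop l.length).map fun _ => false

/-- The pairs of corresponding bits of two words. -/
def binZip (l l' : List Bool) : List (Bool × Bool) := (binPad l l').zip (binPad l' l)

/-- The sum of two words, and its successor. -/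
def binAddAux (l : List (Bool × Bool)) : List Bool × List Bool :=
  l.foldr (fun x s => ((x.1 ^^ x.2) :: bif x.1 && x.2 then s.2 else s.1,
    (!(x.1 ^^ x.2)) :: bif x.1 || x.2 then s.2 else s.1)) ([], [true])

/-- Addition of words. -/
def binAdd (l l' : List Bool) : List Bool := (binAddAux (binZip l l')).1

/-- Multiplication of words. -/
def binMul (l l' : List Bool) : List Bool :=
  l.foldr (fun x s => bif x then binAdd l' (false :: s) else false :: s) []

/-- Comparison of words. -/
def binLe (l l' : List Bool) : Bool :=
  (binZip l l').foldl (fun s x => bif x.1 ^^ x.2 then x.2 else s) true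

theorem binVal_binPad (l l' : List Bool) : binVal (binPad l l') = binVal l := by
  have h : ∀ r : List Bool, binVal (r.map fun _ => false) = 0 := by
    intro r
    induction r with
    | nil => rfl
    | cons b r ih => simpa [binVal] using ih
  unfold binPad
  generalize l'.drop l.length = r
  induction l with
  | nil => simpa [binVal] using h r
  | cons b l ih => simp [binVal] at ih ⊢; omega

theorem length_binPad (l l' : List Bool) :
    (binPad l l').length = max l.length l'.length := by
  simp [binPad]; omega

theorem length_binZip (l l' : List Bool) :
    (binZip l l').length = max l.length l'.length := by
  simp [binZip, length_binPad]; omega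

theorem map_fst_binZip (l l' : List Bool) : (binZip l l').map Prod.fst = binPad l l' :=
  List.map_fst_zip (by simp [length_binPad]; omega)

theorem map_snd_binZip (l l' : List Bool) : (binZip l l').map Prod.snd = binPad l' l :=
  List.map_snd_zip (by simp [length_binPad]; omega)

/-- The right fold treats the significant bits before the carry from below is known. So it maintains
the results for both possible carries, and each new pair of bits selects the one that continues it.
-/
theorem binVal_binAddAux (l : List (Bool × Bool)) :
    binVal (binAddAux l).1 = binVal (l.map Prod.fst) + binVal (l.map Prod.snd) ∧
      binVal (binAddAux l).2 = binVal (l.map Prod.fst) + binVal (l.map Prod.snd) + 1 := by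
  induction l with
  | nil => simp [binAddAux, binVal]
  | cons x l ih =>
    unfold binAddAux at ih ⊢
    obtain ⟨_ | _, _ | _⟩ := x <;> simp [binVal] <;> omega

theorem length_binAddAux (l : List (Bool × Bool)) :
    (binAddAux l).1.length ≤ l.length + 1 ∧ (binAddAux l).2.length ≤ l.length + 1 := by
  induction l with
  | nil => simp [binAddAux]
  | cons x l ih =>
    unfold binAddAux at ih ⊢
    obtain ⟨_ | _, _ | _⟩ := x <;> simp <;> omega

theorem binVal_binAdd (l l' : List Bool) : binVal (binAdd l l') = binVal l + binVal l' := by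
  rw [binAdd, (binVal_binAddAux _).1, map_fst_binZip, map_snd_binZip, binVal_binPad, binVal_binPad]

theorem length_binAdd (l l' : List Bool) :
    (binAdd l l').length ≤ max l.length l'.length + 1 := by
  have := (length_binAddAux (binZip l l')).1
  rwa [length_binZip] at this

theorem binVal_binMul (l l' : List Bool) : binVal (binMul l l') = binVal l * binVal l' := by
  unfold binMul
  induction l with
  | nil => simp [binVal]
  | cons b l ih => cases b <;> simp [binVal, binVal_binAdd, ih] <;> ring

theorem length_binMul (l l' : List Bool) :
    (binMul l l').length ≤ l'.length + 2 * l.length := by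
  unfold binMul
  induction l with
  | nil => simp
  | cons b l ih =>
    cases b
    · simp; omega
    · have := length_binAdd l' (false :: l.foldr
        (fun x s => bif x then binAdd l' (false :: s) else false :: s) [])
      simp at this ⊢
      omega

theorem binLe_iff (l l' : List Bool) : binLe l l' = true ↔ binVal l ≤ binVal l' := by
  -- The accumulator `s` is the verdict on the less significant bits already read. If it is
  -- negative, the remaining words have to satisfy the strict inequality, hence the summand
  -- `(!s).toNat`.
  have key : ∀ (r : List (Bool × Bool)) (s : Bool),
      r.foldl (fun s x => bif x.1 ^^ x.2 then x.2 else s) s = true ↔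
        binVal (r.map Prod.fst) + (!s).toNat ≤ binVal (r.map Prod.snd) := by
    intro r
    induction r with
    | nil => intro s; cases s <;> simp [binVal]
    | cons x r ih =>
      intro s
      rw [List.foldl_cons, ih]
      obtain ⟨_ | _, _ | _⟩ := x <;> cases s <;> simp [binVal] <;> omega
  rw [binLe, key, map_fst_binZip, map_snd_binZip, binVal_binPad, binVal_binPad]
  simp

namespace PolyTime

variable {α : Type} [TreeCode α]

@[fun_prop]
theorem xor {f g : α → Bool} (hf : PolyTime f) (hg : PolyTime g) :
    PolyTime fun a => f a ^^ g a :=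
  (hf.cond (f := fun a => !(g a)) (by fun_prop) hg).of_eq fun a => by cases f a <;> simp

@[fun_prop]
theorem binZip {f g : α → List Bool} (hf : PolyTime f) (hg : PolyTime g) :
    PolyTime fun a => binZip (f a) (g a) := by
  unfold _root_.binZip binPad
  fun_prop

@[fun_prop]
theorem binAdd {f g : α → List Bool} (hf : PolyTime f) (hg : PolyTime g) :
    PolyTime fun a => binAdd (f a) (g a) := by
  unfold _root_.binAdd binAddAux
  refine fst (foldr (binZip hf hg) (const _) (by fun_prop) ?_)
  obtain ⟨p, hp⟩ := (binZip hf hg).size_le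
  refine ⟨4 * p + 10, fun a l hl => ?_⟩
  have h₁ := (tsize_suffix hl).trans (hp a)
  have h₂ := length_lt_tsize l
  have h₃ := length_binAddAux l
  rw [tsize_prod, tsize_word, tsize_word]
  unfold binAddAux at h₃
  simp
  omega

@[fun_prop]
theorem binMul {f g : α → List Bool} (hf : PolyTime f) (hg : PolyTime g) :
    PolyTime fun a => binMul (f a) (g a) := by
  unfold _root_.binMul
  refine foldr (g := fun a x s => bif x then _root_.binAdd (g a) (false :: s) else false :: s)
    hf (const _) (by fun_prop) ?_
  obtain ⟨p, hp⟩ := hf.size_le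
  obtain ⟨q, hq⟩ := hg.size_le
  refine ⟨4 * p + 2 * q + 1, fun a l hl => ?_⟩
  have h₁ := (tsize_suffix hl).trans (hp a)
  have h₂ := hq a
  have h₃ := length_binMul l (g a)
  rw [tsize_word] at h₁ h₂ ⊢
  unfold _root_.binMul at h₃
  simp
  omega

@[fun_prop]
theorem binLe {f g : α → List Bool} (hf : PolyTime f) (hg : PolyTime g) :
    PolyTime fun a => binLe (f a) (g a) := by
  unfold _root_.binLe
  exact foldl (binZip hf hg) (const _) (by fun_prop) ⟨1, fun a l hl => by simp⟩

end PolyTime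

/-! ### Sums of fractions -/

/-- The sum of a list of fractions. -/
def fracSum (l : List (List Bool × List Bool)) : List Bool × List Bool :=
  l.foldr (fun x s => (binAdd (binMul x.2 s.1) (binMul x.1 s.2), binMul x.2 s.2)) ([], [true])

/-- Comparison of fractions. -/
def fracLe (x y : List Bool × List Bool) : Bool := binLe (binMul x.1 y.2) (binMul y.1 x.2)

/-- The value of a fraction. -/
def fracVal (x : List Bool × List Bool) : ℚ≥0 := binVal x.1 / binVal x.2

theorem fracLe_iff {x y : List Bool × List Bool} (hx : binVal x.2 ≠ 0) (hy : binVal y.2 ≠ 0) :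
    fracLe x y = true ↔ fracVal x ≤ fracVal y := by
  have hx' : (0 : ℚ≥0) < binVal x.2 := by exact_mod_cast Nat.pos_of_ne_zero hx
  have hy' : (0 : ℚ≥0) < binVal y.2 := by exact_mod_cast Nat.pos_of_ne_zero hy
  rw [fracLe, binLe_iff, binVal_binMul, binVal_binMul, fracVal, fracVal,
    div_le_div_iff₀ hx' hy']
  norm_cast

theorem fracSum_spec (l : List (List Bool × List Bool)) (hl : ∀ x ∈ l, binVal x.2 ≠ 0) :
    binVal (fracSum l).2 ≠ 0 ∧ fracVal (fracSum l) = (l.map fracVal).sum := by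
  induction l with
  | nil => simp [fracSum, fracVal, binVal]
  | cons x l ih =>
    obtain ⟨h₁, h₂⟩ := ih fun y hy => hl y (by simp [hy])
    have h₃ := hl x (by simp)
    have e : fracSum (x :: l) = (binAdd (binMul x.2 (fracSum l).1) (binMul x.1 (fracSum l).2),
      binMul x.2 (fracSum l).2) := rfl
    rw [e, List.map_cons, List.sum_cons, ← h₂]
    simp only [fracVal, binVal_binMul, binVal_binAdd]
    refine ⟨mul_ne_zero h₃ h₁, ?_⟩
    have h₁' : (binVal (fracSum l).2 : ℚ≥0) ≠ 0 := by exact_mod_cast h₁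
    have h₃' : (binVal x.2 : ℚ≥0) ≠ 0 := by exact_mod_cast h₃
    push_cast
    field_simp
    ring

/-- Fractions are never reduced, yet the lengths stay linear. In `length_binMul` the second factor
counts once and only the first one twice, and the accumulated words are always second factors, so
each entry adds an amount proportional to its own size. -/
theorem length_fracSum (l : List (List Bool × List Bool)) :
    (fracSum l).1.length ≤ tsize l ∧ (fracSum l).2.length ≤ tsize l := by
  induction l with
  | nil => simp [fracSum]
  | cons x l ih =>
    have e : fracSum (x :: l) = (binAdd (binMul x.2 (fracSum l).1) (binMul x.1 (fracSum l).2),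
      binMul x.2 (fracSum l).2) := rfl
    have h₁ := length_binAdd (binMul x.2 (fracSum l).1) (binMul x.1 (fracSum l).2)
    have h₂ := length_binMul x.2 (fracSum l).1
    have h₃ := length_binMul x.1 (fracSum l).2
    have h₄ := length_binMul x.2 (fracSum l).2
    rw [e, tsize_cons, tsize_prod, tsize_word, tsize_word]
    simp only
    omega

namespace PolyTime

variable {α : Type} [TreeCode α]

@[fun_prop]
theorem fracSum {f : α → List (List Bool × List Bool)} (hf : PolyTime f) :
    PolyTime fun a => fracSum (f a) := by
  unfold _root_.fracSum
  refine foldr hf (const _) (by fun_prop) ?_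
  obtain ⟨p, hp⟩ := hf.size_le
  refine ⟨4 * p + 3, fun a l hl => ?_⟩
  have h₁ := (tsize_suffix hl).trans (hp a)
  have h₂ := length_fracSum l
  rw [tsize_prod, tsize_word, tsize_word]
  unfold _root_.fracSum at h₂
  simp
  omega

@[fun_prop]
theorem fracLe {f g : α → List Bool × List Bool} (hf : PolyTime f) (hg : PolyTime g) :
    PolyTime fun a => fracLe (f a) (g a) := by
  unfold _root_.fracLe
  fun_prop

end PolyTime

/-! ### The algorithm

An arc is given by a row of six words: its name, its tail, its head, numerator and denominator of
its weight, and one bit which tells whether it is vulnerable. -/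

/-- The entry of a row at a position. -/
def rowGet : ℕ → List (List Bool) → List Bool
  | 0, r => r.headD []
  | i + 1, r => rowGet i r.tail

/-- The tail of an arc. -/
def rowTail (r : List (List Bool)) : List Bool := rowGet 1 r

/-- The head of an arc. -/
def rowHead (r : List (List Bool)) : List Bool := rowGet 2 r

/-- The weight of an arc. -/
def rowWeight (r : List (List Bool)) : List Bool × List Bool := (rowGet 3 r, rowGet 4 r)

/-- Whether an arc is vulnerable. -/
def rowVul (r : List (List Bool)) : Bool := (rowGet 5 r).headD false

/-- One step of the division of the input into rows of words. The state consists of the current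
word, the current row, the list of the rows before, and the name of the next row. -/
def parseStep (s : List Bool × List (List Bool) × List (List (List Bool)) × List Bool)
    (x : LeafSym) : List Bool × List (List Bool) × List (List (List Bool)) × List Bool :=
  bif decide (x = .bra) then
    ([], [s.2.2.2], s.2.2.1 ++ [s.2.1 ++ [s.1]], true :: s.2.2.2)
  else bif decide (x = .comma) then ([], s.2.1 ++ [s.1], s.2.2)
  else bif decide (x = .bit true) then (s.1 ++ [true], s.2)
  else bif decide (x = .bit false) then (s.1 ++ [false], s.2)
  else s

/-- The division of the input into rows of words. -/
def parse (w : List LeafSym) : List (List (List Bool)) :=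
  (w.foldl parseStep ([], [], [], [])).2.2.1 ++ [(w.foldl parseStep ([], [], [], [])).2.1 ++
    [(w.foldl parseStep ([], [], [], [])).1]]

/-- No arc of the list leads to the tail of `e`. -/
def isSource (l : List (List (List Bool))) (e : List (List Bool)) : Bool :=
  l.all fun f => !decide (rowHead f = rowTail e)

/-- Move those arcs from the first list to the second one which leave sources. -/
def peel (s : List (List (List Bool)) × List (List (List Bool))) :
    List (List (List Bool)) × List (List (List Bool)) :=
  (s.1.filter fun e => !(isSource s.1 e), s.2 ++ s.1.filter fun e => isSource s.1 e)

/-- The arcs in topological order. -/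
def topoSort (l : List (List (List Bool))) : List (List (List Bool)) :=
  (l.foldl (fun s _ => peel s) (l, [])).2

/-- All lists of length `k` over `V`. -/
def allConfigs (V : List (List Bool)) : ℕ → List (List (List Bool))
  | 0 => [[]]
  | k + 1 => (allConfigs V k).flatMap fun c => V.map fun v => v :: c

/-- All tokens on the same vertex. -/
def constConfig (v : List Bool) : ℕ → List (List Bool)
  | 0 => []
  | k + 1 => v :: constConfig v k

/-- Comparison of the costs of two lists of arcs. -/
def costLe (S T : List (List (List Bool))) : Bool :=
  fracLe (fracSum (S.map rowWeight)) (fracSum (T.map rowWeight))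

/-- A cheapest one in a list of lists of arcs, as a list with at most one entry. -/
def cheapest (l : List (List (List (List Bool)))) : List (List (List (List Bool))) :=
  l.foldl (fun s S => bif s.isEmpty || !(costLe (s.headD []) S) then [S] else s) []

/-- Tokens may move along the arc `e` so that the configuration `c` turns into `c'`. -/
def canMove (e : List (List Bool)) (c c' : List (List Bool)) : Bool :=
  ((c.zip c').all fun x => decide (x.1 = x.2) ||
      (decide (x.1 = rowTail e) && decide (x.2 = rowHead e))) &&
    (!(rowVul e) || ((c.zip c').filter fun x => !decide (x.1 = x.2)).tail.isEmpty)

/-- The arcs used to reach the configuration `c` from the entry `q` of a table, if `e` is the next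
arc. -/
def extend (e c : List (List Bool)) (q : List (List Bool) × List (List (List Bool))) :
    List (List (List (List Bool))) :=
  bif decide (q.1 = c) then [q.2] else bif canMove e q.1 c then [e :: q.2] else []

/-- The new table after an arc. -/
def tableStep (C : List (List (List Bool)))
    (T : List (List (List Bool) × List (List (List Bool)))) (e : List (List Bool)) :
    List (List (List Bool) × List (List (List Bool))) :=
  C.flatMap fun c => (cheapest (T.flatMap fun q => extend e c q)).map fun S => (c, S)

/-- The final table: pairs of a configuration and a cheapest list of arcs used to reach it. -/
def table (C : List (List (List Bool))) (c : List (List Bool)) (l : List (List (List Bool))) :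
    List (List (List Bool) × List (List (List Bool))) :=
  l.foldl (tableStep C) [(c, [])]

/-- A cheapest list of arcs that moves `k` tokens from `s` to `t`. -/
def cheapestArcs (k : ℕ) (s t : List Bool) (l : List (List (List Bool))) :
    List (List (List (List Bool))) :=
  cheapest ((table (allConfigs (s :: l.map rowHead) k) (constConfig s k) (topoSort l)).flatMap
    fun q => bif decide (q.1 = constConfig t k) then [q.2] else [])

/-- The word that describes the solution. -/
def solution (l : List (List (List Bool))) (r : List (List (List (List Bool)))) : List LeafSym :=
  bif r.isEmpty then [.nil] else
    l.map fun e => bif (r.headD []).all fun f => !decide (f = e) then .bit false else .bit true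

/-- The algorithm, from the rows of the input to the output. -/
def solve (k : ℕ) (R : List (List (List Bool))) : List LeafSym :=
  solution R.tail (cheapestArcs (k + 1) (rowGet 0 (R.headD [])) (rowGet 1 (R.headD [])) R.tail)

/-! ### Its running time -/

theorem tsize_filter_add {α : Type} [TreeCode α] (p : α → Bool) (l : List α) :
    tsize (l.filter fun x => !(p x)) + tsize (l.filter p) = tsize l + 1 := by
  induction l with
  | nil => rfl
  | cons x l ih => cases h : p x <;> simp [h] <;> omega

/-- Peeling only moves arcs from one list to the other, so the state of the sorting loop has
constant size. -/
theorem tsize_peel (s : List (List (List Bool)) × List (List (List Bool))) :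
    tsize (peel s) = tsize s := by
  have h₁ := tsize_filter_add (isSource s.1) s.1
  have h₂ := tsize_append s.2 (s.1.filter (isSource s.1))
  rw [tsize_prod, tsize_prod]
  change tsize (s.1.filter fun e => !(isSource s.1 e)) +
    tsize (s.2 ++ s.1.filter (isSource s.1)) + 1 = _
  omega

/-- This holds whatever `costLe` answers, so the size bounds that rest on it need no assumption that
the words encode valid weights. -/
theorem cheapest_eq (l : List (List (List (List Bool)))) :
    (l = [] ∧ cheapest l = []) ∨ ∃ S ∈ l, cheapest l = [S] := by
  induction l using List.reverseRecOn with
  | nil => exact .inl ⟨rfl, rfl⟩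
  | append_singleton l S ih =>
    right
    have e : cheapest (l ++ [S]) = bif (cheapest l).isEmpty ||
      !(costLe ((cheapest l).headD []) S) then [S] else cheapest l := by
      simp [cheapest]
    rcases ih with ⟨rfl, h⟩ | ⟨T, hT, h⟩
    · exact ⟨S, by simp, rfl⟩
    · cases h' : costLe T S
      · exact ⟨S, by simp, by simp [e, h, h']⟩
      · exact ⟨T, by simp [hT], by simp [e, h, h']⟩

theorem mem_tableStep {C : List (List (List Bool))} {e c : List (List Bool)}
    {T : List (List (List Bool) × List (List (List Bool)))} {S : List (List (List Bool))}
    (h : (c, S) ∈ tableStep C T e) :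
    c ∈ C ∧ ((c, S) ∈ T ∨ ∃ c' S', (c', S') ∈ T ∧ canMove e c' c = true ∧ S = e :: S') := by
  simp only [tableStep, List.mem_flatMap, List.mem_map] at h
  obtain ⟨c₁, hc₁, S₁, hS₁, h⟩ := h
  simp only [Prod.mk.injEq] at h
  obtain ⟨rfl, rfl⟩ := h
  refine ⟨hc₁, ?_⟩
  rcases cheapest_eq (T.flatMap fun q => extend e c₁ q) with ⟨-, h'⟩ | ⟨S₂, hS₂, h'⟩
  · simp [h'] at hS₁
  · simp only [h', List.mem_singleton] at hS₁
    subst hS₁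
    simp only [List.mem_flatMap, extend] at hS₂
    obtain ⟨⟨c', S'⟩, hq, h⟩ := hS₂
    by_cases hc : c' = c₁
    · simp [hc] at h
      exact .inl (by rwa [h, ← hc])
    · cases hm : canMove e c' c₁
      · simp [hc, hm] at h
      · simp [hc, hm] at h
        exact .inr ⟨c', S', hq, hm, h⟩

theorem length_tableStep_le (C : List (List (List Bool))) (e : List (List Bool))
    (T : List (List (List Bool) × List (List (List Bool)))) :
    (tableStep C T e).length ≤ C.length := by
  unfold tableStep
  induction C with
  | nil => simp
  | cons c C ih =>
    rcases cheapest_eq (T.flatMap fun q => extend e c q) with ⟨-, h⟩ | ⟨S, -, h⟩ <;>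
      simp only [List.flatMap_cons, h] <;> simp at ih ⊢ <;> omega

/-- A table has at most one entry per configuration, and each entry lists at most as many arcs as
have been offered, all of them among the offered ones. This bounds every intermediate table, as the
closure under folds requires. -/
theorem tsize_table_le (C : List (List (List Bool))) (c : List (List Bool))
    (l : List (List (List Bool))) :
    tsize (table C c l) ≤ (tsize C + 1) *
      (tsize c + tsize C + (tsize l * (tsize l + 1) + 1) + 1 + 1) + 1 := by
  -- The initial table has the entry `c`, which need not lie in `C`.
  have key : ∀ l, (table C c l).length ≤ tsize C + 1 ∧ ∀ q ∈ table C c l,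
      (q.1 = c ∨ q.1 ∈ C) ∧ q.2.length ≤ l.length ∧ ∀ f ∈ q.2, f ∈ l := by
    intro l
    induction l using List.reverseRecOn with
    | nil => simp [table]
    | append_singleton l e ih =>
      have h : table C c (l ++ [e]) = tableStep C (table C c l) e := by simp [table]
      rw [h]
      refine ⟨?_, ?_⟩
      · have := length_tableStep_le C e (table C c l)
        have := length_lt_tsize C
        omega
      · rintro ⟨c₁, S⟩ hq
        obtain ⟨h₁, h₂ | ⟨c', S', h₂, -, rfl⟩⟩ := mem_tableStep hq
        · obtain ⟨-, h₃, h₄⟩ := ih.2 _ h₂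
          refine ⟨.inr h₁, by simp at h₃ ⊢; omega, fun f hf => by simp [h₄ f hf]⟩
        · obtain ⟨-, h₃, h₄⟩ := ih.2 _ h₂
          refine ⟨.inr h₁, by simpa using h₃, fun f hf => ?_⟩
          rcases List.mem_cons.1 hf with rfl | hf
          · simp
          · simp [h₄ f hf]
  refine tsize_le_of_forall (key l).1 fun q hq => ?_
  obtain ⟨h₁, h₂, h₃⟩ := (key l).2 q hq
  have h₄ := length_lt_tsize l
  have h₅ : tsize q.2 ≤ tsize l * (tsize l + 1) + 1 :=
    tsize_le_of_forall (by omega) fun f hf => tsize_le_of_mem (h₃ f hf)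
  have h₆ : tsize q.1 ≤ tsize c + tsize C := by
    rcases h₁ with h | h
    · rw [h]; omega
    · have := tsize_le_of_mem h; omega
  rw [tsize_prod]
  omega

namespace PolyTime

variable {α : Type} [TreeCode α]

@[fun_prop]
theorem decideEqSym {f : α → LeafSym} (hf : PolyTime f) (c : LeafSym) :
    PolyTime fun a => decide (f a = c) :=
  (eq_sym c).comp hf

@[fun_prop]
theorem rowGet (i : ℕ) {f : α → List (List Bool)} (hf : PolyTime f) :
    PolyTime fun a => rowGet i (f a) := by
  induction i generalizing f with
  | zero => unfold _root_.rowGet; fun_prop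
  | succ i ih => exact ih (tail hf)

@[fun_prop]
theorem rowTail {f : α → List (List Bool)} (hf : PolyTime f) :
    PolyTime fun a => rowTail (f a) := rowGet 1 hf

@[fun_prop]
theorem rowHead {f : α → List (List Bool)} (hf : PolyTime f) :
    PolyTime fun a => rowHead (f a) := rowGet 2 hf

@[fun_prop]
theorem rowWeight {f : α → List (List Bool)} (hf : PolyTime f) :
    PolyTime fun a => rowWeight (f a) := by
  unfold _root_.rowWeight; fun_prop

@[fun_prop]
theorem rowVul {f : α → List (List Bool)} (hf : PolyTime f) :
    PolyTime fun a => rowVul (f a) := by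
  unfold _root_.rowVul; fun_prop

@[fun_prop]
theorem parse : PolyTime parse := by
  have h : PolyTime fun w : List LeafSym => w.foldl parseStep ([], [], [], []) := by
    refine foldl (g := fun _ => parseStep) id (const _) (by unfold parseStep; fun_prop) ?_
    refine ⟨7 + Polynomial.X * (2 * Polynomial.X + 20), fun w l hl => ?_⟩
    -- The unary name grows by one bit with each arc and is copied into a row at each `bra`. A
    -- single symbol thus adds at most linearly to the state, and the whole state stays quadratic.
    have key : tsize (l.foldl parseStep ([], [], [], [])).2.2.2 ≤ 2 * l.length + 1 ∧
        tsize (l.foldl parseStep ([], [], [], [])) ≤ 7 + l.length * (2 * tsize w + 20) := by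
      have hlw : l.length ≤ tsize w := by
        have h₁ := hl.length_le
        have h₂ := length_lt_tsize w
        omega
      clear hl
      induction l using List.reverseRecOn with
      | nil => simp
      | append_singleton l x ih =>
        simp only [List.length_append, List.length_singleton] at hlw
        obtain ⟨ih₁, ih₂⟩ := ih (by omega)
        rw [List.foldl_append, List.foldl_cons, List.foldl_nil]
        generalize l.foldl parseStep ([], [], [], []) = s at ih₁ ih₂ ⊢
        obtain ⟨s₁, s₂, s₃, s₄⟩ := s
        have h₁ := tsize_append s₂ [s₁]
        have h₂ := tsize_append s₃ [s₂ ++ [s₁]]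
        have h₃ := fun b => tsize_append s₁ [b]
        have h₄ := h₃ true
        have h₅ := h₃ false
        simp only [tsize_cons, tsize_nil, tsize_pair, tsize_bool, add_mul, one_mul,
          List.length_append, List.length_singleton] at *
        cases x with
        | nil => simp [parseStep]; omega
        | bit b => cases b <;> simp [parseStep] <;> omega
        | bra => simp [parseStep]; omega
        | comma => simp [parseStep]; omega
    have h₁ : l.length ≤ tsize w := by
      have h₁ := hl.length_le
      have h₂ := length_lt_tsize w
      omega
    have h₂ := Nat.mul_le_mul_right (2 * tsize w + 20) h₁
    have h₃ := key.2
    simp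
    omega
  unfold _root_.parse
  fun_prop

@[fun_prop]
theorem peel : PolyTime peel := by
  unfold _root_.peel isSource
  fun_prop

@[fun_prop]
theorem topoSort {f : α → List (List (List Bool))} (hf : PolyTime f) :
    PolyTime fun a => topoSort (f a) := by
  unfold _root_.topoSort
  refine snd (foldl (g := fun _ s _ => _root_.peel s) hf (by fun_prop) (by fun_prop) ?_)
  obtain ⟨p, hp⟩ := hf.size_le
  refine ⟨p + 2, fun a l hl => ?_⟩
  have key : ∀ l : List (List (List Bool)),
      tsize (l.foldl (fun s _ => _root_.peel s) (f a, [])) = tsize (f a) + 2 := by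
    intro l
    induction l using List.reverseRecOn with
    | nil => simp
    | append_singleton l x ih => simp [tsize_peel, ih]
  have := hp a
  rw [key]
  simp
  omega

-- The induction is on the constant `k`, so the resulting polynomial may depend on it; the number of
-- configurations is the `k`-th power of the number of words.
@[fun_prop]
theorem allConfigs {f : α → List (List Bool)} (hf : PolyTime f) (k : ℕ) :
    PolyTime fun a => allConfigs (f a) k := by
  induction k with
  | zero => unfold _root_.allConfigs; fun_prop
  | succ k ih => unfold _root_.allConfigs; fun_prop

@[fun_prop]
theorem constConfig {f : α → List Bool} (hf : PolyTime f) (k : ℕ) :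
    PolyTime fun a => constConfig (f a) k := by
  induction k with
  | zero => unfold _root_.constConfig; fun_prop
  | succ k ih => unfold _root_.constConfig; fun_prop

@[fun_prop]
theorem costLe {f g : α → List (List (List Bool))} (hf : PolyTime f) (hg : PolyTime g) :
    PolyTime fun a => costLe (f a) (g a) := by
  unfold _root_.costLe
  fun_prop

@[fun_prop]
theorem cheapest {f : α → List (List (List (List Bool)))} (hf : PolyTime f) :
    PolyTime fun a => cheapest (f a) := by
  unfold _root_.cheapest
  refine foldl hf (const _) (by fun_prop) ?_
  obtain ⟨p, hp⟩ := hf.size_le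
  refine ⟨p + 3, fun a l hl => ?_⟩
  have h := (tsize_prefix hl).trans (hp a)
  change tsize (_root_.cheapest l) ≤ _
  rcases cheapest_eq l with ⟨-, e⟩ | ⟨S, hS, e⟩
  · simp [e]
  · have := tsize_le_of_mem hS
    simp [e]
    omega

@[fun_prop]
theorem canMove {e c c' : α → List (List Bool)} (he : PolyTime e) (hc : PolyTime c)
    (hc' : PolyTime c') : PolyTime fun a => canMove (e a) (c a) (c' a) := by
  unfold _root_.canMove
  fun_prop

@[fun_prop]
theorem tableStep {C : α → List (List (List Bool))}
    {T : α → List (List (List Bool) × List (List (List Bool)))} {e : α → List (List Bool)}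
    (hC : PolyTime C) (hT : PolyTime T) (he : PolyTime e) :
    PolyTime fun a => tableStep (C a) (T a) (e a) := by
  unfold _root_.tableStep extend
  fun_prop

@[fun_prop]
theorem table {C : α → List (List (List Bool))} {c : α → List (List Bool)}
    {l : α → List (List (List Bool))} (hC : PolyTime C) (hc : PolyTime c) (hl : PolyTime l) :
    PolyTime fun a => table (C a) (c a) (l a) := by
  unfold _root_.table
  refine foldl (g := fun a => _root_.tableStep (C a)) hl (by fun_prop) (by fun_prop) ?_
  obtain ⟨p, hp⟩ := hC.size_le
  obtain ⟨q, hq⟩ := hc.size_le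
  obtain ⟨r, hr⟩ := hl.size_le
  refine ⟨(p + 1) * (q + p + (r * (r + 1) + 1) + 1 + 1) + 1, fun a l' hl' => ?_⟩
  have h₁ := (tsize_prefix hl').trans (hr a)
  refine (tsize_table_le (C a) (c a) l').trans ?_
  simp only [Polynomial.eval_add, Polynomial.eval_mul, Polynomial.eval_one]
  have h₂ := hp a
  have h₃ := hq a
  gcongr

theorem solve (k : ℕ) : PolyTime (solve k) := by
  unfold _root_.solve solution cheapestArcs
  fun_prop

end PolyTime

/-! ### The input -/

/-- The stack symbols as labels of leaves; `Γ'.ket` is not needed. -/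
def LeafSym.ofΓ' : Γ' → LeafSym
  | .blank => .nil
  | .bit b => .bit b
  | .bra => .bra
  | .ket => .nil
  | .comma => .comma

namespace FTPInstance

variable (I : FTPInstance)

/-- The name of a vertex. -/
def vertexWord (v : Fin I.n) : List Bool := encodeNat v

/-- The row of words that stands for an arc. -/
def row (e : Fin I.m) : List (List Bool) :=
  [List.replicate e true, I.vertexWord (I.tail e), I.vertexWord (I.head e),
    encodeNat (I.weight e).num, encodeNat (I.weight e).den, [decide (e ∈ I.M)]]

theorem vertexWord_injective : Function.Injective I.vertexWord := fun _ _ h =>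
  Fin.ext (encodingNatBool.encode_injective h)

/-- The index in unary keeps apart parallel arcs that agree in all other data. -/
theorem row_injective : Function.Injective I.row := by
  intro e f h
  have := congrArg List.length (List.cons.inj h).1
  simpa [Fin.ext_iff] using this

@[simp] theorem rowTail_row (e : Fin I.m) : rowTail (I.row e) = I.vertexWord (I.tail e) := rfl
@[simp] theorem rowHead_row (e : Fin I.m) : rowHead (I.row e) = I.vertexWord (I.head e) := rfl
@[simp] theorem rowVul_row (e : Fin I.m) : rowVul (I.row e) = decide (e ∈ I.M) := rfl

theorem binVal_den_row (e : Fin I.m) : binVal (rowWeight (I.row e)).2 ≠ 0 := by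
  change binVal (encodeNat _) ≠ 0
  rw [binVal_encodeNat]
  exact NNRat.den_ne_zero _

theorem fracVal_row (e : Fin I.m) : fracVal (rowWeight (I.row e)) = I.weight e := by
  change (binVal (encodeNat _) : ℚ≥0) / (binVal (encodeNat _) : ℚ≥0) = _
  rw [binVal_encodeNat, binVal_encodeNat, NNRat.num_div_den]

theorem foldl_parseStep_natCode (x : ℕ) (F : List (List Bool)) (R : List (List (List Bool)))
    (c : List Bool) : ((natCode x).map LeafSym.ofΓ').foldl parseStep ([], F, R, c) =
      ([], F ++ [encodeNat x], R, c) := by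
  have key : ∀ (w cur : List Bool), ((w.map Γ'.bit).map LeafSym.ofΓ').foldl parseStep
      (cur, F, R, c) = (cur ++ w, F, R, c) := by
    intro w
    induction w with
    | nil => simp
    | cons b w ih =>
      intro cur
      have : parseStep (cur, F, R, c) (LeafSym.ofΓ' (Γ'.bit b)) = (cur ++ [b], F, R, c) := by
        cases b <;> simp [parseStep, LeafSym.ofΓ']
      rw [List.map_cons, List.map_cons, List.foldl_cons, this, ih]
      simp
  rw [natCode, List.map_append, List.foldl_append, key]
  simp [parseStep, LeafSym.ofΓ']

/-- A row is closed only by the next `bra` or by the end of the input. Right after an arc its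
vulnerability bit is therefore still the current word, and its row lacks that entry. -/
theorem foldl_parseStep_arcCode (e : Fin I.m) (cur : List Bool) (F : List (List Bool))
    (R : List (List (List Bool))) (c : List Bool) :
    ((I.arcCode e).map LeafSym.ofΓ').foldl parseStep (cur, F, R, c) =
      ([decide (e ∈ I.M)], [c, I.vertexWord (I.tail e), I.vertexWord (I.head e),
        encodeNat (I.weight e).num, encodeNat (I.weight e).den], R ++ [F ++ [cur]], true :: c) := by
  have h : parseStep (cur, F, R, c) (LeafSym.ofΓ' Γ'.bra) =
      ([], [c], R ++ [F ++ [cur]], true :: c) := rfl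
  have h' : ∀ (b : Bool) F R c, parseStep ([], F, R, c) (LeafSym.ofΓ' (Γ'.bit b)) =
      ([b], F, R, c) := by
    intro b F R c
    cases b <;> rfl
  have h'' : ∀ s, parseStep s (LeafSym.ofΓ' Γ'.ket) = s := fun s => rfl
  simp only [arcCode, List.map_cons, List.map_append, List.foldl_cons, List.foldl_append, h,
    foldl_parseStep_natCode, h', h'', List.map_nil, List.foldl_nil,
    List.cons_append, List.nil_append, vertexWord]

/-- The header row ends with an empty word because no word has been begun after its last comma when
the row is closed. The blanks that count the vertices are skipped; the algorithm needs only the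
terminals and the ends of the arcs. -/
theorem parse_encode : parse (I.encode.map LeafSym.ofΓ') =
    [I.vertexWord I.s, I.vertexWord I.t, []] :: (List.finRange I.m).map I.row := by
  have h₀ : ∀ n s, ((List.replicate n Γ'.blank).map LeafSym.ofΓ').foldl parseStep s = s := by
    intro n
    induction n with
    | zero => simp
    | succ n ih => intro s; exact ih s
  have key : ∀ j ≤ I.m, ∀ s, (((List.finRange I.m).take j).flatMap I.arcCode |>.map
      LeafSym.ofΓ').foldl parseStep ([], [I.vertexWord I.s, I.vertexWord I.t], [], []) = s →
      s.2.2.1 ++ [s.2.1 ++ [s.1]] = [I.vertexWord I.s, I.vertexWord I.t, []] ::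
        ((List.finRange I.m).take j).map I.row ∧ s.2.2.2 = List.replicate j true := by
    intro j
    induction j with
    | zero => rintro - s rfl; simp
    | succ j ih =>
      rintro hj s rfl
      obtain ⟨ih₁, ih₂⟩ := ih (by omega) _ rfl
      have e : (List.finRange I.m).take (j + 1) = (List.finRange I.m).take j ++ [⟨j, hj⟩] := by
        rw [List.take_add_one]
        simp [Nat.lt_of_succ_le hj]
      rw [e, List.flatMap_append, List.map_append, List.foldl_append]
      generalize List.foldl parseStep _ _ = s at ih₁ ih₂ ⊢
      obtain ⟨s₁, s₂, s₃, s₄⟩ := s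
      simp only at ih₁ ih₂
      subst ih₂
      simp only [List.flatMap_singleton, foldl_parseStep_arcCode]
      rw [ih₁]
      simp [row, List.replicate_succ]
  have h₁ : (I.encode.map LeafSym.ofΓ').foldl parseStep ([], [], [], []) =
      (((List.finRange I.m).take I.m).flatMap I.arcCode |>.map
        LeafSym.ofΓ').foldl parseStep ([], [I.vertexWord I.s, I.vertexWord I.t], [], []) := by
    rw [encode, List.map_append, List.map_append, List.map_append, List.foldl_append,
      List.foldl_append, List.foldl_append, h₀, foldl_parseStep_natCode, foldl_parseStep_natCode,
      List.take_of_length_le (by simp)]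
    rfl
  have h₂ := (key I.m le_rfl _ rfl).1
  rw [← h₁, List.take_of_length_le (by simp)] at h₂
  exact h₂

end FTPInstance

/-! ### Topological order -/

/-- Each round removes at least one arc as long as any is left, so as many rounds as there are arcs
suffice. An arc moved in some round has a tail that no remaining arc enters, including those moved
in the same round, so the order within a round is irrelevant. -/
theorem topoSort_spec {l : List (List (List Bool))}
    (hl : ∀ r : List (List (List Bool)), r ≠ [] → r ⊆ l →
      ∃ e ∈ r, ∀ f ∈ r, rowHead f ≠ rowTail e) :
    (topoSort l).Perm l ∧ (topoSort l).Pairwise fun e f => rowHead f ≠ rowTail e := by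
  have key : ∀ r : List (List (List Bool)), ∀ s, r.foldl (fun s _ => peel s) (l, []) = s →
      (s.1 ++ s.2).Perm l ∧ s.2.Pairwise (fun e f => rowHead f ≠ rowTail e) ∧
      (∀ e ∈ s.2, ∀ f ∈ s.1, rowHead f ≠ rowTail e) ∧ s.1.length ≤ l.length - r.length := by
    intro r
    induction r using List.reverseRecOn with
    | nil => rintro s rfl; simp
    | append_singleton r x ih =>
      rintro s rfl
      obtain ⟨h₁, h₂, h₃, h₄⟩ := ih _ rfl
      rw [List.foldl_append, List.foldl_cons, List.foldl_nil]
      generalize List.foldl (fun s _ => peel s) (l, []) r = s at h₁ h₂ h₃ h₄ ⊢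
      obtain ⟨rem, out⟩ := s
      simp only at h₁ h₂ h₃ h₄
      have hs : ∀ e, isSource rem e = true → ∀ f ∈ rem, rowHead f ≠ rowTail e := by
        intro e he
        simpa [isSource] using he
      refine ⟨?_, ?_, ?_, ?_⟩
      · refine List.Perm.trans ?_ h₁
        have h := List.filter_append_perm (isSource rem) rem
        refine List.Perm.trans ?_ (h.append_right out)
        simp only [peel]
        rw [List.append_assoc]
        refine (List.perm_append_comm (l₁ := rem.filter fun e => !(isSource rem e))).trans ?_
        rw [List.append_assoc]
        exact List.perm_append_comm.trans (by rw [List.append_assoc])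
      · simp only [peel, List.pairwise_append]
        refine ⟨h₂, ?_, fun e he f hf => h₃ e he f (List.mem_of_mem_filter hf)⟩
        exact List.pairwise_of_forall_mem_list fun e he f hf =>
          hs e (List.mem_filter.1 he).2 f (List.mem_of_mem_filter hf)
      · intro e he f hf
        simp only [peel, List.mem_append] at he hf
        have hf := List.mem_of_mem_filter hf
        rcases he with he | he
        · exact h₃ e he f hf
        · exact hs e (List.mem_filter.1 he).2 f hf
      · simp only [peel, List.length_append, List.length_singleton]
        by_cases hr : rem = []
        · simp [hr]
        · obtain ⟨e, he, hf⟩ := hl rem hr fun f hf => h₁.subset (by simp [hf])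
          have : (rem.filter fun e => !(isSource rem e)).length < rem.length := by
            refine List.length_filter_lt_length_iff_exists.2 ⟨e, he, ?_⟩
            simpa [isSource] using hf
          omega
  obtain ⟨h₁, h₂, -, h₄⟩ := key l _ rfl
  have h₅ : (l.foldl (fun s _ => peel s) (l, [])).1 = [] := by
    rw [← List.length_eq_zero_iff]
    omega
  rw [h₅] at h₁
  exact ⟨h₁, h₂⟩

/-! ### The table -/

/-- `TokenRun c₀ l c S`: tokens that start in the configuration `c₀` can reach `c` when the arcs
of `l` are offered one after the other, and `S` lists the arcs that are used. -/
inductive TokenRun (c₀ : List (List Bool)) : List (List (List Bool)) → List (List Bool) →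
    List (List (List Bool)) → Prop
  | nil : TokenRun c₀ [] c₀ []
  | keep {l c S} (e) (h : TokenRun c₀ l c S) : TokenRun c₀ (l ++ [e]) c S
  | move {l c c' S e} (h : TokenRun c₀ l c S) (hc : c.length = c'.length)
      (he : canMove e c c' = true) : TokenRun c₀ (l ++ [e]) c' (e :: S)

namespace TokenRun

variable {c₀ c : List (List Bool)} {l S : List (List (List Bool))}

theorem length_eq (h : TokenRun c₀ l c S) : c.length = c₀.length := by
  induction h with
  | nil => rfl
  | keep e h ih => exact ih
  | move h hc he ih => omega

/-- An arc is recorded at most once per offer, and the latest one comes first. Hence a run over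
distinct arcs pays for none of them twice. -/
theorem sublist (h : TokenRun c₀ l c S) : S.reverse.Sublist l := by
  induction h with
  | nil => simp
  | keep e h ih => exact ih.trans (List.sublist_append_left _ _)
  | @move l c c' S e h hc he ih => simpa using ih.append_right [e]

theorem subset (h : TokenRun c₀ l c S) : S ⊆ l := by
  have := h.sublist.subset
  rwa [List.reverse_subset] at this

theorem nodup (h : TokenRun c₀ l c S) (hl : l.Nodup) : S.Nodup := by
  simpa using hl.sublist h.sublist

end TokenRun

theorem canMove_iff {e c c' : List (List Bool)} : canMove e c c' = true ↔
    (∀ x ∈ c.zip c', x.1 = x.2 ∨ (x.1 = rowTail e ∧ x.2 = rowHead e)) ∧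
      (rowVul e = true → ((c.zip c').filter fun x => !decide (x.1 = x.2)).length ≤ 1) := by
  have h : ∀ l : List (List Bool × List Bool), l.tail.isEmpty = true ↔ l.length ≤ 1 := by
    rintro (_ | ⟨_, _ | _⟩) <;> simp
  rw [canMove, Bool.and_eq_true, Bool.or_eq_true, h, List.all_eq_true]
  cases rowVul e <;> simp

theorem mem_allConfigs {V : List (List Bool)} {k : ℕ} {c : List (List Bool)} :
    c ∈ allConfigs V k ↔ c.length = k ∧ ∀ v ∈ c, v ∈ V := by
  induction k generalizing c with
  | zero => simp [allConfigs]; rintro rfl; simp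
  | succ k ih =>
    simp only [allConfigs, List.mem_flatMap, List.mem_map, ih]
    cases c with
    | nil => simp
    | cons v c => simp; tauto

theorem TokenRun.of_mem_table {V : List (List Bool)} {c₀ c : List (List Bool)}
    {l S : List (List (List Bool))} (h : (c, S) ∈ table (allConfigs V c₀.length) c₀ l) :
    TokenRun c₀ l c S := by
  induction l using List.reverseRecOn generalizing c S with
  | nil =>
    simp [table] at h
    obtain ⟨rfl, rfl⟩ := h
    exact .nil
  | append_singleton l e ih =>
    have h' : (c, S) ∈ tableStep (allConfigs V c₀.length) (table (allConfigs V c₀.length) c₀ l)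
      e := by simpa [table] using h
    obtain ⟨h₁, h₂ | ⟨c', S', h₂, h₃, rfl⟩⟩ := mem_tableStep h'
    · exact .keep e (ih h₂)
    · exact .move (ih h₂) ((ih h₂).length_eq.trans (mem_allConfigs.1 h₁).1.symm) h₃

/-- The cost of a list of arcs. -/
def rowsCost (S : List (List (List Bool))) : ℚ≥0 := (S.map fun e => fracVal (rowWeight e)).sum

theorem costLe_iff {S T : List (List (List Bool))} (hS : ∀ e ∈ S, binVal (rowWeight e).2 ≠ 0)
    (hT : ∀ e ∈ T, binVal (rowWeight e).2 ≠ 0) : costLe S T = true ↔ rowsCost S ≤ rowsCost T := by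
  obtain ⟨h₁, h₂⟩ := fracSum_spec (S.map rowWeight) (by simpa using hS)
  obtain ⟨h₃, h₄⟩ := fracSum_spec (T.map rowWeight) (by simpa using hT)
  rw [costLe, fracLe_iff h₁ h₃, h₂, h₄]
  simp [rowsCost, Function.comp_def]

theorem cheapest_spec {L : List (List (List (List Bool)))}
    (hL : ∀ S ∈ L, ∀ e ∈ S, binVal (rowWeight e).2 ≠ 0) {S : List (List (List Bool))}
    (hS : S ∈ L) : ∃ T ∈ L, cheapest L = [T] ∧ rowsCost T ≤ rowsCost S := by
  induction L using List.reverseRecOn generalizing S with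
  | nil => simp at hS
  | append_singleton L R ih =>
    have e : cheapest (L ++ [R]) = bif (cheapest L).isEmpty ||
      !(costLe ((cheapest L).headD []) R) then [R] else cheapest L := by
      simp [cheapest]
    have ih := @ih fun S hS => hL S (by simp [hS])
    rcases List.eq_nil_or_concat L with rfl | ⟨L', S₀, rfl⟩
    · simp at hS
      subst hS
      exact ⟨S, by simp, rfl, le_rfl⟩
    generalize hL' : L'.concat S₀ = L at *
    have hS₀ : S₀ ∈ L := by simp [← hL']
    obtain ⟨T₀, hT₀, h₀, -⟩ := ih hS₀
    have hc := costLe_iff (hL T₀ (by simp [hT₀])) (hL R (by simp))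
    rw [e, h₀]
    simp only [List.mem_append, List.mem_singleton] at hS
    cases h : costLe T₀ R
    · refine ⟨R, by simp, by simp [h], ?_⟩
      rcases hS with hS | rfl
      · obtain ⟨T, hT, h₁, h₂⟩ := ih hS
        rw [h₀, List.cons.injEq] at h₁
        obtain ⟨rfl, -⟩ := h₁
        rw [h] at hc
        have : ¬ rowsCost T₀ ≤ rowsCost R := fun h' => by simp [h'] at hc
        exact (le_of_not_ge this).trans h₂
      · exact le_rfl
    · refine ⟨T₀, by simp [hT₀], by simp [h], ?_⟩
      rcases hS with hS | rfl
      · obtain ⟨T, hT, h₁, h₂⟩ := ih hS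
        rw [h₀, List.cons.injEq] at h₁
        obtain ⟨rfl, -⟩ := h₁
        exact h₂
      · exact hc.1 h

/-- The principle of dynamic programming: the cost is additive and the possible next moves depend on
the configuration alone, so the history of a run can be replaced by the entry of the table for the
same configuration, which is no dearer. -/
theorem TokenRun.mem_table {V : List (List Bool)} {c₀ c : List (List Bool)}
    {l S : List (List (List Bool))} (h : TokenRun c₀ l c S)
    (hl : ∀ e ∈ l, binVal (rowWeight e).2 ≠ 0 ∧ rowHead e ∈ V) (hc₀ : ∀ v ∈ c₀, v ∈ V) :
    (∀ v ∈ c, v ∈ V) ∧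
      ∃ S', (c, S') ∈ table (allConfigs V c₀.length) c₀ l ∧ rowsCost S' ≤ rowsCost S := by
  have step : ∀ (l : List (List (List Bool))) (e c c' : List (List Bool))
      (S S₁ : List (List (List Bool))), (∀ f ∈ l ++ [e], binVal (rowWeight f).2 ≠ 0) →
      c'.length = c₀.length → (∀ v ∈ c', v ∈ V) →
      (c, S) ∈ table (allConfigs V c₀.length) c₀ l → S₁ ∈ extend e c' (c, S) →
      ∃ S', (c', S') ∈ table (allConfigs V c₀.length) c₀ (l ++ [e]) ∧
        rowsCost S' ≤ rowsCost S₁ := by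
    intro l e c c' S S₁ hl hc' hV hS hS₁
    have h : S₁ ∈ (table (allConfigs V c₀.length) c₀ l).flatMap (extend e c') :=
      List.mem_flatMap.2 ⟨_, hS, hS₁⟩
    have hg : ∀ S₂ ∈ (table (allConfigs V c₀.length) c₀ l).flatMap (extend e c'),
        ∀ f ∈ S₂, binVal (rowWeight f).2 ≠ 0 := by
      intro S₂ hS₂ f hf
      obtain ⟨⟨c₂, S₃⟩, h₃, h₄⟩ := List.mem_flatMap.1 hS₂
      have h₅ := (TokenRun.of_mem_table h₃).subset
      refine hl f ?_
      by_cases h₆ : c₂ = c'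
      · simp [extend, h₆] at h₄
        subst h₄
        simp [h₅ hf]
      · cases h₇ : canMove e c₂ c'
        · simp [extend, h₆, h₇] at h₄
        · simp [extend, h₆, h₇] at h₄
          subst h₄
          rcases List.mem_cons.1 hf with rfl | hf
          · simp
          · simp [h₅ hf]
    obtain ⟨T, hT, h₁, h₂⟩ := cheapest_spec hg h
    refine ⟨T, ?_, h₂⟩
    have e : table (allConfigs V c₀.length) c₀ (l ++ [e]) =
      tableStep (allConfigs V c₀.length) (table (allConfigs V c₀.length) c₀ l) e := by
        simp [table]
    rw [e, tableStep, List.mem_flatMap]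
    exact ⟨c', mem_allConfigs.2 ⟨hc', hV⟩, List.mem_map.2 ⟨T, by rw [h₁]; simp, rfl⟩⟩
  induction h with
  | nil => exact ⟨hc₀, [], by simp [table], le_rfl⟩
  | @keep l c S e h ih =>
    obtain ⟨ih₁, S', ih₂, ih₃⟩ := ih fun f hf => hl f (by simp [hf])
    obtain ⟨S₂, h₁, h₂⟩ := step l e c c S' S' (fun f hf => (hl f hf).1) h.length_eq ih₁ ih₂
      (by simp [extend])
    exact ⟨ih₁, S₂, h₁, h₂.trans ih₃⟩
  | @move l c c' S e h hc he ih =>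
    obtain ⟨ih₁, S', ih₂, ih₃⟩ := ih fun f hf => hl f (by simp [hf])
    have hV : ∀ v ∈ c', v ∈ V := by
      intro v hv
      obtain ⟨i, hi, rfl⟩ := List.getElem_of_mem hv
      have h₁ : ((c)[i], (c')[i]) ∈ c.zip c' :=
        List.mem_iff_getElem.2 ⟨i, by simp [hi]; omega, by simp⟩
      rcases (canMove_iff.1 he).1 _ h₁ with h₂ | ⟨-, h₂⟩
      · simp only at h₂
        rw [← h₂]
        exact ih₁ _ (List.getElem_mem _)
      · simp only at h₂
        rw [h₂]
        exact (hl e (by simp)).2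
    refine ⟨hV, ?_⟩
    -- `extend` never charges for an arc when the configuration does not change. A run that does so
    -- is matched by one that stays put, since weights are non-negative.
    by_cases hcc : c = c'
    · obtain ⟨S₂, h₁, h₂⟩ := step l e c c' S' S' (fun f hf => (hl f hf).1)
        (hc.symm.trans h.length_eq) hV ih₂ (by simp [extend, hcc])
      refine ⟨S₂, h₁, (h₂.trans ih₃).trans ?_⟩
      simp [rowsCost]
    · obtain ⟨S₂, h₁, h₂⟩ := step l e c c' S' (e :: S') (fun f hf => (hl f hf).1)
        (hc.symm.trans h.length_eq) hV ih₂ (by simp [extend, hcc, he])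
      refine ⟨S₂, h₁, h₂.trans ?_⟩
      simpa [rowsCost] using ih₃

/-! ### Integral flows -/

namespace FTPInstance

variable (I : FTPInstance)

/-- The amount of a flow that enters a vertex. -/
def inflow (f : Fin I.m → ℕ) (v : Fin I.n) : ℕ := ∑ e, if I.head e = v then f e else 0

/-- The amount of a flow that leaves a vertex. -/
def outflow (f : Fin I.m → ℕ) (v : Fin I.n) : ℕ := ∑ e, if I.tail e = v then f e else 0

theorem inflow_add_single (f : Fin I.m → ℕ) (e : Fin I.m) (v : Fin I.n) :
    I.inflow (f + Pi.single e 1) v = I.inflow f v + if I.head e = v then 1 else 0 := by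
  have h : ∀ i, (if I.head i = v then (f + Pi.single e 1 : Fin I.m → ℕ) i else 0) =
      (if I.head i = v then f i else 0) + if i = e then (if I.head e = v then 1 else 0) else 0 := by
    intro i
    by_cases hi : i = e
    · subst hi; by_cases h : I.head i = v <;> simp [h]
    · simp [hi]
  simp only [inflow, h, Finset.sum_add_distrib, Finset.sum_ite_eq', Finset.mem_univ, if_true]

theorem outflow_add_single (f : Fin I.m → ℕ) (e : Fin I.m) (v : Fin I.n) :
    I.outflow (f + Pi.single e 1) v = I.outflow f v + if I.tail e = v then 1 else 0 := by
  have h : ∀ i, (if I.tail i = v then (f + Pi.single e 1 : Fin I.m → ℕ) i else 0) =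
      (if I.tail i = v then f i else 0) + if i = e then (if I.tail e = v then 1 else 0) else 0 := by
    intro i
    by_cases hi : i = e
    · subst hi; by_cases h : I.tail i = v <;> simp [h]
    · simp [hi]
  simp only [outflow, h, Finset.sum_add_distrib, Finset.sum_ite_eq', Finset.mem_univ, if_true]

/-- A flow of value `r` from `s` to `t`. -/
def IsFlow (c : Fin I.m → ℕ) (r : ℕ) (f : Fin I.m → ℕ) : Prop :=
  (∀ e, f e ≤ c e) ∧
    ∀ v, (if v = I.s then r else 0) + I.inflow f v = I.outflow f v + if v = I.t then r else 0

variable {I}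

theorem HasPath.exists_leaving {X : Finset (Fin I.m)} {u v : Fin I.n} (h : I.HasPath X u v)
    {U : Finset (Fin I.n)} (hu : u ∈ U) (hv : v ∉ U) : ∃ e ∈ X, I.tail e ∈ U ∧ I.head e ∉ U := by
  induction h with
  | refl => exact (hv hu).elim
  | @tail b c _ hbc ih =>
    by_cases hb : b ∈ U
    · obtain ⟨e, he, rfl, rfl⟩ := hbc
      exact ⟨e, he, hb, hv⟩
    · exact ih hb

/-- The augmenting path argument without paths. Let `U` be a maximal set containing `s` such that,
for every `x` in `U`, the flow can be altered on arcs inside `U` alone so as to bring one additional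
unit from `s` to `x`. If `t` is in `U`, the value has been raised. Otherwise `U` is the cut: an
unsaturated arc that leaves it, or an arc with flow that enters it, would allow `U` to grow. -/
theorem exists_isFlow_succ_or_cut {c f : Fin I.m → ℕ} {r : ℕ} (hf : I.IsFlow c r f) :
    (∃ g, I.IsFlow c (r + 1) g) ∨ ∃ U : Finset (Fin I.n), I.s ∈ U ∧ I.t ∉ U ∧
      (∀ e, I.tail e ∈ U → I.head e ∉ U → f e = c e) ∧
      (∀ e, I.tail e ∉ U → I.head e ∈ U → f e = 0) := by
  classical
  -- The agreement of `g` with `f` off `U` guarantees that the residual capacity of a boundary arc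
  -- under `f` is still available under `g`.
  let Q : Finset (Fin I.n) → Prop := fun U => I.s ∈ U ∧ ∀ x ∈ U, ∃ g : Fin I.m → ℕ,
    (∀ e, g e ≤ c e) ∧ (∀ e, ¬ (I.tail e ∈ U ∧ I.head e ∈ U) → g e = f e) ∧
    ∀ v, (if v = I.s then r + 1 else 0) + I.inflow g v =
      I.outflow g v + (if v = I.t then r else 0) + if v = x then 1 else 0
  have hQ : Q {I.s} := by
    refine ⟨by simp, fun x hx => ⟨f, hf.1, fun _ _ => rfl, fun v => ?_⟩⟩
    have := hf.2 v
    simp only [Finset.mem_singleton] at hx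
    subst hx
    split_ifs at this ⊢ <;> omega
  obtain ⟨U, hU⟩ := (Set.toFinite {U | Q U}).exists_maximal ⟨_, hQ⟩
  obtain ⟨⟨hs, hg⟩, hmax⟩ := hU
  have hmax : ∀ y ∉ U, ¬ Q (insert y U) := fun y hy h =>
    hy (hmax h (Finset.subset_insert y U) (Finset.mem_insert_self y U))
  have extendQ : ∀ y ∉ U, (∃ g : Fin I.m → ℕ, (∀ e, g e ≤ c e) ∧
      (∀ e, ¬ (I.tail e ∈ insert y U ∧ I.head e ∈ insert y U) → g e = f e) ∧
      ∀ v, (if v = I.s then r + 1 else 0) + I.inflow g v =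
        I.outflow g v + (if v = I.t then r else 0) + if v = y then 1 else 0) → False := by
    intro y hy hgy
    refine hmax y hy ⟨Finset.mem_insert_of_mem hs, fun x hx => ?_⟩
    rcases Finset.mem_insert.1 hx with rfl | hx
    · exact hgy
    · obtain ⟨g, h₁, h₂, h₃⟩ := hg x hx
      exact ⟨g, h₁, fun e he => h₂ e fun h => he
        ⟨Finset.mem_insert_of_mem h.1, Finset.mem_insert_of_mem h.2⟩, h₃⟩
  by_cases ht : I.t ∈ U
  · left
    obtain ⟨g, h₁, -, h₃⟩ := hg _ ht
    refine ⟨g, h₁, fun v => ?_⟩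
    have := h₃ v
    split_ifs at this ⊢ <;> omega
  · right
    refine ⟨U, hs, ht, fun e he he' => ?_, fun e he he' => ?_⟩
    · by_contra hne
      obtain ⟨g, h₁, h₂, h₃⟩ := hg _ he
      refine extendQ _ he' ⟨g + Pi.single e 1, fun i => ?_, fun i hi => ?_, fun v => ?_⟩
      · by_cases hi : i = e
        · subst hi
          have := h₂ i fun h => he' h.2
          have := hf.1 i
          simp
          omega
        · simpa [hi] using h₁ i
      · have hie : i ≠ e := by
          rintro rfl
          exact hi ⟨Finset.mem_insert_of_mem he, Finset.mem_insert_self _ _⟩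
        simpa [hie] using h₂ i fun h => hi
          ⟨Finset.mem_insert_of_mem h.1, Finset.mem_insert_of_mem h.2⟩
      · have := h₃ v
        rw [inflow_add_single, outflow_add_single]
        simp only [eq_comm (a := v)] at this ⊢
        omega
    · by_contra hne
      obtain ⟨g, h₁, h₂, h₃⟩ := hg _ he'
      have hge : g e = f e := h₂ e fun h => he h.1
      -- The extra unit is passed on backwards by cancelling one unit on `e`. Writing `g` as a sum
      -- avoids subtraction of natural numbers.
      obtain ⟨g', rfl⟩ : ∃ g' : Fin I.m → ℕ, g = g' + Pi.single e 1 := by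
        refine ⟨g - Pi.single e 1, funext fun i => ?_⟩
        by_cases hi : i = e
        · subst hi
          simp
          omega
        · simp [hi]
      refine extendQ _ he ⟨g', fun i => (Nat.le_add_right _ _).trans (h₁ i), fun i hi => ?_,
        fun v => ?_⟩
      · have hie : i ≠ e := by
          rintro rfl
          exact hi ⟨Finset.mem_insert_self _ _, Finset.mem_insert_of_mem he'⟩
        have := h₂ i fun h => hi
          ⟨Finset.mem_insert_of_mem h.1, Finset.mem_insert_of_mem h.2⟩
        simpa [hie] using this
      · have := h₃ v
        rw [inflow_add_single, outflow_add_single] at this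
        simp only [eq_comm (a := v)] at this ⊢
        omega

/-- Summing the conservation law over `U`, the arcs inside `U` cancel, entering arcs carry nothing,
and leaving arcs are saturated. -/
theorem IsFlow.value_eq {c f : Fin I.m → ℕ} {r : ℕ} (hf : I.IsFlow c r f)
    {U : Finset (Fin I.n)} (hs : I.s ∈ U) (ht : I.t ∉ U)
    (h₁ : ∀ e, I.tail e ∈ U → I.head e ∉ U → f e = c e)
    (h₂ : ∀ e, I.tail e ∉ U → I.head e ∈ U → f e = 0) :
    r = ∑ e with I.tail e ∈ U ∧ I.head e ∉ U, c e := by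
  have h := Finset.sum_congr (rfl : U = U) fun v _ => hf.2 v
  simp only [Finset.sum_add_distrib, Finset.sum_ite_eq', hs, ht, if_true, if_false, add_zero,
    inflow, outflow] at h
  rw [Finset.sum_comm, Finset.sum_comm (s := U)] at h
  simp only [Finset.sum_ite_eq] at h
  have h₃ : ∀ e, (if I.tail e ∈ U then f e else 0) = (if I.head e ∈ U then f e else 0) +
      if I.tail e ∈ U ∧ I.head e ∉ U then c e else 0 := by
    intro e
    have := h₁ e
    have := h₂ e
    by_cases h₄ : I.tail e ∈ U <;> by_cases h₅ : I.head e ∈ U <;> simp_all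
  simp only [h₃, Finset.sum_add_distrib] at h
  rw [Finset.sum_filter]
  omega

/-- A feasible set carries an integral flow of value `k + 1` which uses every vulnerable arc at
most once. -/
theorem IsFeasible.exists_isFlow {k : ℕ} {S : Finset (Fin I.m)} (hS : I.IsFeasible k S) :
    ∃ f, I.IsFlow (fun e => if e ∈ S then if e ∈ I.M then 1 else k + 1 else 0) (k + 1) f := by
  classical
  set c : Fin I.m → ℕ := fun e => if e ∈ S then if e ∈ I.M then 1 else k + 1 else 0 with hc
  suffices h : ∀ r ≤ k + 1, ∃ f, I.IsFlow c r f from h _ le_rfl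
  intro r
  induction r with
  | zero => exact fun _ => ⟨0, fun e => Nat.zero_le _, fun v => by simp [inflow, outflow]⟩
  | succ r ih =>
    intro hr
    obtain ⟨f, hf⟩ := ih (by omega)
    rcases exists_isFlow_succ_or_cut hf with h | ⟨U, hs, ht, h₁, h₂⟩
    · exact h
    · exfalso
      have hv := hf.value_eq hs ht h₁ h₂
      -- If augmentation stops at a value `r ≤ k`, the cut has capacity `r`, so at most `k`
      -- vulnerable arcs of `S` cross it. These are taken as the faults. The path that survives them
      -- crosses the cut on a safe arc, whose capacity `k + 1` exceeds that of the whole cut.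
      let F : Finset (Fin I.m) := {e | (I.tail e ∈ U ∧ I.head e ∉ U) ∧ e ∈ S ∧ e ∈ I.M}
      have hF : F.card ≤ k := by
        have : F.card ≤ ∑ e with I.tail e ∈ U ∧ I.head e ∉ U, c e := by
          rw [Finset.card_eq_sum_ones, Finset.sum_filter, Finset.sum_filter]
          refine Finset.sum_le_sum fun e _ => ?_
          by_cases h₃ : I.tail e ∈ U ∧ I.head e ∉ U
          · by_cases h₄ : e ∈ S ∧ e ∈ I.M
            · simp [hc, h₃, h₄]
            · simp [h₄]
          · simp [h₃]
        omega
      obtain ⟨e, he, he₁, he₂⟩ := (hS F (fun e he => (Finset.mem_filter.1 he).2.2.2)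
        hF).exists_leaving hs ht
      have he₃ : c e = k + 1 := by
        simp only [F, Finset.mem_sdiff, Finset.mem_filter, Finset.mem_univ, true_and] at he
        have : e ∉ I.M := fun h => he.2 ⟨⟨he₁, he₂⟩, he.1, h⟩
        simp [hc, he.1, this]
      have he₄ : c e ≤ ∑ e with I.tail e ∈ U ∧ I.head e ∉ U, c e :=
        Finset.single_le_sum (f := c) (fun _ _ => Nat.zero_le _) (by simp [he₁, he₂])
      omega

end FTPInstance

/-! ### Moving tokens -/

/-- To be applied with `p` marking the far side of a cut: a vulnerable arc takes at most one token
across, and an arc that does not lead across takes none. -/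
theorem countP_le_of_canMove {e c c' : List (List Bool)} (h : canMove e c c' = true)
    (hc : c.length = c'.length) (p : List Bool → Bool) :
    (rowVul e = true → c'.countP p ≤ c.countP p + 1) ∧
      ((p (rowHead e) = true → p (rowTail e) = true) → c'.countP p ≤ c.countP p) := by
  obtain ⟨h₁, h₂⟩ := canMove_iff.1 h
  have key : ∀ c c' : List (List Bool), c.length = c'.length →
      (∀ x ∈ c.zip c', x.1 = x.2 ∨ (x.1 = rowTail e ∧ x.2 = rowHead e)) →
      c'.countP p ≤ c.countP p + ((c.zip c').filter fun x => !decide (x.1 = x.2)).length ∧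
      ((p (rowHead e) = true → p (rowTail e) = true) → c'.countP p ≤ c.countP p) := by
    intro c
    induction c with
    | nil => rintro (_ | _) <;> simp
    | cons x c ih =>
      rintro (_ | ⟨y, c'⟩) hc h₁
      · simp at hc
      · obtain ⟨ih₁, ih₂⟩ := ih c' (by simpa using hc) fun z hz => h₁ z (by simp [hz])
        have h₃ := h₁ (x, y) (by simp)
        simp only at h₃
        simp only [List.countP_cons, List.zip_cons_cons, List.filter_cons]
        refine ⟨?_, fun hp => ?_⟩
        · rcases h₃ with rfl | -
          · simp
            omega
          · by_cases hxy : x = y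
            · simp [hxy]
              omega
            · simp [hxy]
              split_ifs <;> omega
        · have := ih₂ hp
          rcases h₃ with rfl | ⟨rfl, rfl⟩
          · omega
          · split_ifs with h₄ h₅ <;> first | omega | exact absurd (hp h₄) h₅
  obtain ⟨h₃, h₄⟩ := key c c' hc h₁
  exact ⟨fun hv => h₃.trans (by have := h₂ hv; omega), h₄⟩

/-- A flow prescribes only how many tokens move, not which ones; the first `j` tokens found on the
tail are chosen. -/
theorem exists_canMove {e c : List (List Bool)} {j : ℕ} (hj : j ≤ c.count (rowTail e))
    (hv : rowVul e = true → j ≤ 1) : ∃ c' : List (List Bool), c.length = c'.length ∧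
      canMove e c c' = true ∧ ∀ x, c'.count x + (if rowTail e = x then j else 0) =
        c.count x + if rowHead e = x then j else 0 := by
  suffices h : ∃ c' : List (List Bool), c.length = c'.length ∧
      (∀ x ∈ c.zip c', x.1 = x.2 ∨ (x.1 = rowTail e ∧ x.2 = rowHead e)) ∧
      ((c.zip c').filter fun x => !decide (x.1 = x.2)).length ≤ j ∧
      ∀ x, c'.count x + (if rowTail e = x then j else 0) =
        c.count x + if rowHead e = x then j else 0 by
    obtain ⟨c', h₁, h₂, h₃, h₄⟩ := h
    exact ⟨c', h₁, canMove_iff.2 ⟨h₂, fun h => h₃.trans (hv h)⟩, h₄⟩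
  clear hv
  induction c generalizing j with
  | nil =>
    simp at hj
    subst hj
    exact ⟨[], by simp⟩
  | cons y c ih =>
    by_cases hy : 1 ≤ j ∧ y = rowTail e
    · obtain ⟨hj', rfl⟩ := hy
      obtain ⟨j, rfl⟩ := Nat.exists_eq_add_of_le' hj'
      obtain ⟨c', h₁, h₂, h₃, h₄⟩ := ih (j := j) (by simpa using hj)
      refine ⟨rowHead e :: c', by simpa using h₁, ?_, ?_, fun x => ?_⟩
      · simp only [List.zip_cons_cons, List.mem_cons]
        rintro x (rfl | hx)
        · exact .inr ⟨rfl, rfl⟩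
        · exact h₂ x hx
      · simp only [List.zip_cons_cons, List.filter_cons]
        split_ifs
        · simpa using h₃
        · omega
      · have := h₄ x
        simp only [List.count_cons, beq_iff_eq]
        split_ifs at this ⊢ <;> omega
    · obtain ⟨c', h₁, h₂, h₃, h₄⟩ := ih (j := j) (by
        rw [List.count_cons] at hj
        by_cases h : y = rowTail e
        · have : j = 0 := by
            by_contra h'
            exact hy ⟨by omega, h⟩
          omega
        · simpa [h] using hj)
      refine ⟨y :: c', by simpa using h₁, ?_, ?_, fun x => ?_⟩
      · simp only [List.zip_cons_cons, List.mem_cons]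
        rintro x (rfl | hx)
        · exact .inl rfl
        · exact h₂ x hx
      · simpa [List.filter_cons] using h₃
      · have := h₄ x
        simp only [List.count_cons]
        omega

theorem constConfig_eq_replicate (v : List Bool) (k : ℕ) :
    constConfig v k = List.replicate k v := by
  induction k with
  | zero => rfl
  | succ k ih => simp [constConfig, ih, List.replicate_succ]

namespace FTPInstance

variable {I : FTPInstance}

/-- The arcs that tokens use on their way from `s` to `t` form a feasible set. -/
theorem isFeasible_of_tokenRun {k : ℕ} {L : List (Fin I.m)} (hL : L.Nodup)
    {S : List (List (List Bool))} (h : TokenRun (constConfig (I.vertexWord I.s) (k + 1))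
      (L.map I.row) (constConfig (I.vertexWord I.t) (k + 1)) S) :
    I.IsFeasible k {e | I.row e ∈ S} := by
  classical
  intro F hFM hF
  by_contra hP
  set X : Finset (Fin I.m) := ({e | I.row e ∈ S} : Finset (Fin I.m)) \ F with hX
  -- `p` marks the vertices that cannot be reached from `s` once the faults are removed.
  let p : List Bool → Bool := fun w => decide (∃ v, I.vertexWord v = w ∧ ¬ I.HasPath X I.s v)
  have hp : ∀ v, p (I.vertexWord v) = true ↔ ¬ I.HasPath X I.s v := by
    intro v
    simp only [p, decide_eq_true_eq]
    constructor
    · rintro ⟨u, hu, h⟩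
      rwa [I.vertexWord_injective hu] at h
    · exact fun h => ⟨v, rfl, h⟩
  -- Tokens cross to the unreachable side only on arcs of `F`, and each of these, being vulnerable,
  -- takes at most one. So at most `k` of the `k + 1` tokens get across, and they cannot all stand
  -- on an unreachable `t`.
  have key : ∀ (l : List (List (List Bool))) (c : List (List Bool)) (S' : List (List (List Bool))),
      TokenRun (constConfig (I.vertexWord I.s) (k + 1)) l c S' → (∀ r ∈ l, ∃ e, I.row e = r) →
      S' ⊆ S → c.countP p ≤ l.countP fun r => decide (∃ e ∈ F, I.row e = r) := by
    intro l c S' h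
    induction h with
    | nil =>
      intro _ _
      have : p (I.vertexWord I.s) = false := by
        rw [← Bool.not_eq_true, hp, not_not]
        exact .refl
      simp [constConfig_eq_replicate, List.countP_replicate, this]
    | keep e h ih =>
      intro hl hS
      have := ih (fun r hr => hl r (by simp [hr])) hS
      rw [List.countP_append]
      omega
    | @move l c c' S' r h hc he ih =>
      intro hl hS
      have ih := ih (fun r hr => hl r (by simp [hr])) fun x hx => hS (by simp [hx])
      obtain ⟨e, rfl⟩ := hl r (by simp)
      obtain ⟨h₁, h₂⟩ := countP_le_of_canMove he hc p
      rw [List.countP_append, List.countP_singleton]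
      by_cases heF : e ∈ F
      · have h₃ := h₁ (by simpa using hFM heF)
        rw [if_pos (by simpa using ⟨e, heF, rfl⟩)]
        omega
      -- An arc that is used and not in `F` belongs to `X`, so its head is reachable whenever its
      -- tail is.
      · refine (h₂ fun h => ?_).trans (ih.trans (Nat.le_add_right _ _))
        rw [rowHead_row, hp] at h
        rw [rowTail_row, hp]
        refine fun h' => h (h'.tail ⟨e, ?_, rfl, rfl⟩)
        simpa [hX, heF] using hS (by simp)
  have h₁ := key _ _ _ h (fun r hr => by
    obtain ⟨e, -, he⟩ := List.mem_map.1 hr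
    exact ⟨e, he⟩) (List.Subset.refl _)
  have h₂ : p (I.vertexWord I.t) = true := (hp _).2 hP
  rw [constConfig_eq_replicate, List.countP_replicate, if_pos h₂, List.countP_map,
    List.countP_eq_length_filter] at h₁
  have h₃ : (L.filter ((fun r => decide (∃ e ∈ F, I.row e = r)) ∘ I.row)).length ≤ F.card := by
    rw [← List.toFinset_card_of_nodup (hL.filter _)]
    refine Finset.card_le_card fun e he => ?_
    simp only [List.mem_toFinset, List.mem_filter, Function.comp_apply, decide_eq_true_eq] at he
    obtain ⟨-, e', he', h⟩ := he
    rwa [← I.row_injective h]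
  omega

/-- A flow of value `k` turns into tokens that move from `s` to `t`. -/
theorem IsFlow.exists_tokenRun {c f : Fin I.m → ℕ} {k : ℕ} (hf : I.IsFlow c k f)
    (hM : ∀ e ∈ I.M, f e ≤ 1) {L : List (Fin I.m)} (hL : L.Perm (List.finRange I.m))
    (hL' : L.Pairwise fun e f => I.head f ≠ I.tail e) (hI : ∀ e, I.head e ≠ I.tail e) :
    ∃ S, TokenRun (constConfig (I.vertexWord I.s) k) (L.map I.row)
      (constConfig (I.vertexWord I.t) k) S ∧ ∀ r ∈ S, ∃ e, f e ≠ 0 ∧ I.row e = r := by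
  have hin : ∀ v, (L.map fun e => if I.head e = v then f e else 0).sum = I.inflow f v := by
    intro v
    rw [inflow, Fin.sum_univ_def]
    exact (hL.map _).sum_eq
  have hout : ∀ v, (L.map fun e => if I.tail e = v then f e else 0).sum = I.outflow f v := by
    intro v
    rw [outflow, Fin.sum_univ_def]
    exact (hL.map _).sum_eq
  -- After the arcs of `P` have been offered, the number of tokens on `v` is the initial supply plus
  -- what `P` brings to `v` minus what it takes away.
  have key : ∀ P Q : List (Fin I.m), P ++ Q = L → ∃ c S,
      TokenRun (constConfig (I.vertexWord I.s) k) (P.map I.row) c S ∧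
      (∀ r ∈ S, ∃ e, f e ≠ 0 ∧ I.row e = r) ∧
      ∀ v, c.count (I.vertexWord v) + (P.map fun e => if I.tail e = v then f e else 0).sum =
        (if v = I.s then k else 0) + (P.map fun e => if I.head e = v then f e else 0).sum := by
    intro P
    induction P using List.reverseRecOn with
    | nil =>
      intro Q _
      refine ⟨_, _, .nil, by simp, fun v => ?_⟩
      rw [constConfig_eq_replicate, List.count_replicate]
      simp [I.vertexWord_injective.eq_iff, eq_comm (a := v)]
    | append_singleton P e ih =>
      intro Q hQ
      obtain ⟨c, S, h₁, h₂, h₃⟩ := ih (e :: Q) (by simpa using hQ)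
      -- By the topological order neither `e` nor a later arc enters the tail of `e`. All inflow has
      -- thus arrived, and conservation leaves at least `f e` tokens there.
      have hle : f e ≤ c.count (I.vertexWord (I.tail e)) := by
        have h₄ := h₃ (I.tail e)
        have h₅ := hin (I.tail e)
        have h₆ := hout (I.tail e)
        have h₇ := hf.2 (I.tail e)
        have h₈ : (Q.map fun i => if I.head i = I.tail e then f i else 0).sum = 0 := by
          rw [List.sum_eq_zero_iff]
          simp only [List.mem_map]
          rintro _ ⟨i, hi, rfl⟩
          rw [← hQ, List.append_assoc, List.pairwise_append] at hL'
          have := (List.pairwise_cons.1 hL'.2.1).1 i (by simpa using hi)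
          simp [this]
        rw [← hQ] at h₅ h₆
        simp only [List.map_append, List.sum_append, List.map_cons, List.map_nil, List.sum_cons,
          List.sum_nil, if_true, hI, if_false] at h₅ h₆
        omega
      by_cases hfe : f e = 0
      · refine ⟨c, S, by simpa using h₁.keep (I.row e), h₂, fun v => ?_⟩
        simpa [hfe] using h₃ v
      · obtain ⟨c', h₄, h₅, h₆⟩ := exists_canMove (e := I.row e) (c := c) (j := f e)
          (by simpa using hle) (fun h => hM e (by simpa using h))
        refine ⟨c', I.row e :: S, by simpa using h₁.move h₄ h₅, ?_, fun v => ?_⟩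
        · intro r hr
          rcases List.mem_cons.1 hr with rfl | hr
          · exact ⟨e, hfe, rfl⟩
          · exact h₂ r hr
        · have h₇ := h₃ v
          have h₈ := h₆ (I.vertexWord v)
          simp only [rowTail_row, rowHead_row, I.vertexWord_injective.eq_iff] at h₈
          simp only [List.map_append, List.sum_append, List.map_cons, List.map_nil, List.sum_cons,
            List.sum_nil]
          omega
  obtain ⟨c, S, h₁, h₂, h₃⟩ := key L [] (by simp)
  refine ⟨S, ?_, h₂⟩
  have h₄ := h₃ I.t
  rw [hin, hout] at h₄
  have h₅ := hf.2 I.t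
  rw [if_pos rfl] at h₅
  have h₆ : c.length = k := by
    rw [h₁.length_eq, constConfig_eq_replicate, List.length_replicate]
  -- Conservation at `t` leaves a surplus of `k`, which is the number of all tokens.
  have h₇ : c.count (I.vertexWord I.t) = c.length := by omega
  rw [List.count_eq_length] at h₇
  have h₈ : c = List.replicate k (I.vertexWord I.t) :=
    List.eq_replicate_iff.2 ⟨h₆, fun b hb => (h₇ b hb).symm⟩
  rwa [constConfig_eq_replicate (I.vertexWord I.t), ← h₈]

end FTPInstance

/-! ### Correctness of the algorithm on acyclic graphs. -/

namespace FTPInstance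

variable {I : FTPInstance}

theorem IsAcyclic.head_ne_tail (hI : I.IsAcyclic) (e : Fin I.m) : I.head e ≠ I.tail e := fun h =>
  hI (I.tail e) (.single ⟨e, Finset.mem_univ _, rfl, h⟩)

/-- On an acyclic graph reachability by a nonempty walk is a strict order on a finite set; an arc of
`A` with minimal tail is as required. -/
theorem IsAcyclic.exists_source (hI : I.IsAcyclic) {A : Set (Fin I.m)} (hA : A.Nonempty) :
    ∃ e ∈ A, ∀ f ∈ A, I.head f ≠ I.tail e := by
  let r := Relation.TransGen (I.Adj Finset.univ)
  have : IsTrans (Fin I.n) r := ⟨fun _ _ _ => Relation.TransGen.trans⟩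
  have : Std.Irrefl r := ⟨hI⟩
  obtain ⟨v, ⟨e, he, rfl⟩, hv⟩ :=
    (Finite.wellFounded_of_trans_of_irrefl r).has_min (I.tail '' A) (hA.image _)
  refine ⟨e, he, fun f hf h => hv (I.tail f) ⟨f, hf, rfl⟩ ?_⟩
  exact .single ⟨f, Finset.mem_univ _, rfl, h⟩

theorem IsAcyclic.exists_topoSort_eq (hI : I.IsAcyclic) : ∃ L : List (Fin I.m),
    topoSort ((List.finRange I.m).map I.row) = L.map I.row ∧ L.Perm (List.finRange I.m) ∧
      L.Pairwise fun e f => I.head f ≠ I.tail e := by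
  obtain ⟨h₁, h₂⟩ := topoSort_spec (l := (List.finRange I.m).map I.row) <| by
    intro r hr hr'
    have hA : {e | I.row e ∈ r}.Nonempty := by
      obtain ⟨x, hx⟩ := List.exists_mem_of_ne_nil r hr
      obtain ⟨e, -, rfl⟩ := List.mem_map.1 (hr' hx)
      exact ⟨e, hx⟩
    obtain ⟨e, he, h⟩ := hI.exists_source hA
    refine ⟨I.row e, he, fun f hf => ?_⟩
    obtain ⟨f, -, rfl⟩ := List.mem_map.1 (hr' hf)
    rw [rowHead_row, rowTail_row, I.vertexWord_injective.ne_iff]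
    exact h f hf
  obtain ⟨L, hL⟩ : topoSort ((List.finRange I.m).map I.row) ∈ Set.range (List.map I.row) := by
    rw [Set.range_list_map]
    intro x hx
    obtain ⟨e, -, rfl⟩ := List.mem_map.1 (h₁.subset hx)
    exact ⟨e, rfl⟩
  rw [← hL] at h₁ h₂
  refine ⟨L, hL.symm, (List.map_perm_map_iff I.row_injective).1 h₁, ?_⟩
  rw [List.pairwise_map] at h₂
  refine h₂.imp fun {e f} h => ?_
  rwa [rowHead_row, rowTail_row, I.vertexWord_injective.ne_iff] at h

theorem rowsCost_eq_cost {S : List (List (List Bool))} (hS : S.Nodup)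
    (h : ∀ r ∈ S, ∃ e, I.row e = r) : rowsCost S = I.cost {e | I.row e ∈ S} := by
  classical
  rw [rowsCost, ← List.sum_toFinset _ hS, cost]
  have e : S.toFinset = ({e | I.row e ∈ S} : Finset (Fin I.m)).image I.row := by
    ext r
    simp only [List.mem_toFinset, Finset.mem_image, Finset.mem_filter, Finset.mem_univ, true_and]
    constructor
    · intro hr
      obtain ⟨e, rfl⟩ := h r hr
      exact ⟨e, hr, rfl⟩
    · rintro ⟨e, he, rfl⟩
      exact he
  rw [e, Finset.sum_image fun _ _ _ _ h => I.row_injective h]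
  simp only [fracVal_row]

/-- The answer of the algorithm. -/
theorem IsAcyclic.exists_isAnswer (hI : I.IsAcyclic) (k : ℕ) : ∃ a, I.IsAnswer k a ∧
    (solve k (parse (I.encode.map LeafSym.ofΓ'))).map LeafSym.toΓ' = encodeAnswer a := by
  classical
  obtain ⟨L, hL, hp, ho⟩ := hI.exists_topoSort_eq
  have hnd : L.Nodup := hp.nodup_iff.2 (List.nodup_finRange _)
  rw [I.parse_encode]
  set R := (List.finRange I.m).map I.row with hR
  -- Tokens stand only on `s` and on heads of arcs, so configurations over these vertices suffice.
  set V := I.vertexWord I.s :: R.map rowHead with hV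
  set c₀ := constConfig (I.vertexWord I.s) (k + 1) with hc₀
  set c₁ := constConfig (I.vertexWord I.t) (k + 1) with hc₁
  set W := (table (allConfigs V (k + 1)) c₀ (L.map I.row)).flatMap
    fun q => bif decide (q.1 = c₁) then [q.2] else [] with hW
  have hlen : c₀.length = k + 1 := by simp [hc₀, constConfig_eq_replicate]
  have hrow : ∀ {c S}, TokenRun c₀ (L.map I.row) c S → ∀ r ∈ S, ∃ e, I.row e = r := by
    intro c S h r hr
    obtain ⟨e, -, he⟩ := List.mem_map.1 (h.subset hr)
    exact ⟨e, he⟩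
  have hW₁ : ∀ S, S ∈ W ↔ (c₁, S) ∈ table (allConfigs V (k + 1)) c₀ (L.map I.row) := by
    intro S
    simp only [hW, List.mem_flatMap]
    constructor
    · rintro ⟨⟨c, T⟩, h, h'⟩
      by_cases hc : c = c₁
      · simp only [hc, decide_true, cond_true, List.mem_singleton] at h'
        rwa [h', ← hc]
      · simp [hc] at h'
    · exact fun h => ⟨_, h, by simp⟩
  have hW₂ : ∀ S ∈ W, TokenRun c₀ (L.map I.row) c₁ S := fun S hS =>
    TokenRun.of_mem_table (V := V) (by rw [hlen]; exact (hW₁ S).1 hS)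
  -- A flow inside `T` yields a run whose arcs all carry flow and hence belong to `T`; the table
  -- contains a run that costs no more. In particular, an empty `W` rules out feasible sets.
  have hW₃ : ∀ T, I.IsFeasible k T → ∃ S ∈ W, rowsCost S ≤ I.cost T := by
    intro T hT
    obtain ⟨f, hf⟩ := hT.exists_isFlow
    obtain ⟨S, h₁, h₂⟩ := hf.exists_tokenRun (fun e he => (hf.1 e).trans (by
      simp only [he, if_true]
      split_ifs <;> simp)) hp ho hI.head_ne_tail
    obtain ⟨-, S', h₃, h₄⟩ := h₁.mem_table (V := V) (by
      intro r hr
      obtain ⟨e, -, rfl⟩ := List.mem_map.1 hr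
      refine ⟨I.binVal_den_row e, List.mem_cons_of_mem _ (List.mem_map.2 ⟨I.row e, ?_, rfl⟩)⟩
      exact List.mem_map.2 ⟨e, List.mem_finRange e, rfl⟩) (by
      intro v hv
      rw [constConfig_eq_replicate] at hv
      rw [List.eq_of_mem_replicate hv]
      exact List.mem_cons_self)
    rw [← hc₀, hlen] at h₃
    refine ⟨S', (hW₁ S').2 h₃, h₄.trans ?_⟩
    rw [rowsCost_eq_cost (h₁.nodup (hnd.map I.row_injective)) (hrow h₁)]
    refine Finset.sum_le_sum_of_subset fun e he => ?_
    obtain ⟨e', h₅, h₆⟩ := h₂ (I.row e) (Finset.mem_filter.1 he).2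
    rw [I.row_injective h₆] at h₅
    by_contra heT
    have := hf.1 e
    simp only [heT, if_false] at this
    omega
  have hsol : solve k ([I.vertexWord I.s, I.vertexWord I.t, []] :: R) =
      solution R (cheapest W) := by
    rw [solve, cheapestArcs]
    change solution R (cheapest ((table (allConfigs V (k + 1)) c₀ (topoSort R)).flatMap
      fun q => bif decide (q.1 = c₁) then [q.2] else [])) = _
    rw [hL]
  rw [hsol]
  rcases cheapest_eq W with ⟨h, h'⟩ | ⟨S, hS, h⟩
  · refine ⟨none, fun T hT => ?_, by rw [h']; rfl⟩
    obtain ⟨S, hS, -⟩ := hW₃ T hT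
    simp [h] at hS
  · have hS' := hW₂ S hS
    refine ⟨some ({e | I.row e ∈ S} : Finset (Fin I.m)), ⟨isFeasible_of_tokenRun hnd hS', fun T hT => ?_⟩, ?_⟩
    · rw [← rowsCost_eq_cost (hS'.nodup (hnd.map I.row_injective)) (hrow hS')]
      obtain ⟨S₁, hS₁, h₁⟩ := hW₃ T hT
      obtain ⟨S₂, -, h₂, h₃⟩ := cheapest_spec (fun S₃ hS₃ r hr => by
        obtain ⟨e, rfl⟩ := hrow (hW₂ S₃ hS₃) r hr
        exact I.binVal_den_row e) hS₁
      rw [h, List.cons.injEq] at h₂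
      rw [h₂.1]
      exact h₃.trans h₁
    · rw [h, encodeAnswer, List.ofFn_eq_map, solution, hR]
      simp only [List.isEmpty_cons, cond_false, List.headD_cons, List.map_map]
      refine List.map_congr_left fun e _ => ?_
      have : (S.all fun f => !decide (f = I.row e)) = !decide (I.row e ∈ S) := by
        rw [Bool.eq_iff_iff]
        simp
        exact ⟨fun h h' => h _ h' rfl, fun h f hf hf' => h (hf' ▸ hf)⟩
      by_cases he : I.row e ∈ S <;> simp [this, he, LeafSym.toΓ']

end FTPInstance

/-! ### Input and output of the machine -/

namespace Prog

/-- Turn the input into the code of a list, in reverse. -/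
def readInput : Prog := seq (push .val .val fun _ => Γ'.blank)
  (loop .inp Option.isSome (seq (push .val .inp fun x => (LeafSym.ofΓ' (x.getD Γ'.blank)).toΓ')
    (seq (pop .inp) (push .val .val fun _ => Γ'.ket))))

/-- Prepending to the code of a list takes just the symbol and a `ket`. The symbols are read from
the front, so the list comes out reversed. -/
theorem runs_readInput (w : List Γ') :
    Runs readInput (Function.update (fun _ => []) .inp w)
      (store (enc (w.map LeafSym.ofΓ').reverse).code [] []) (4 * w.length + 2) := by
  have key : ∀ (w : List Γ') (l : List LeafSym), Runs (loop .inp Option.isSome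
      (seq (push .val .inp fun x => (LeafSym.ofΓ' (x.getD Γ'.blank)).toΓ')
        (seq (pop .inp) (push .val .val fun _ => Γ'.ket))))
      (Function.update (store (enc l).code [] []) .inp w)
      (store (enc ((w.map LeafSym.ofΓ').reverse ++ l)).code [] []) (4 * w.length + 1) := by
    intro w
    induction w with
    | nil =>
      intro l
      refine (Runs.loop_done (by simp) (by simp)).congr ?_
      funext k
      cases k <;> simp [store]
    | cons x w ih =>
      intro l
      refine (Runs.loop_step (by simp) (Runs.seq (.push le_rfl) (Runs.seq (.pop le_rfl)
        (.push le_rfl) le_rfl) le_rfl) (Eq.subst (motive := fun S => Runs _ S _ _) ?_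
          ((ih (LeafSym.ofΓ' x :: l)).congr ?_)) ?_)
      · funext k
        cases k <;> simp [store, enc, encList, BinTree.code]
      · simp
      · simp only [List.length_cons]
        omega
  refine Runs.seq (.push le_rfl) (Eq.subst (motive := fun S => Runs _ S _ _) ?_
    ((key w []).congr (by simp))) (by omega)
  funext k
  cases k <;> simp [store, enc, encList, BinTree.code, LeafSym.toΓ']

/-- Turn the code of a list into the output, in reverse. -/
def writeOutput : Prog := seq (loop .val (· == some Γ'.ket) (seq (pop .val) (moveTop .val .out)))
  (pop .val)

theorem runs_writeOutput (l : List LeafSym) :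
    Runs writeOutput (store (enc l).code [] [])
      (Function.update (fun _ => []) .out (l.map LeafSym.toΓ').reverse) (4 * l.length + 2) := by
  have key : ∀ (l : List LeafSym) (w : List Γ'), Runs (loop .val (· == some Γ'.ket)
      (seq (pop .val) (moveTop .val .out))) (Function.update (store (enc l).code [] []) .out w)
      (Function.update (store [Γ'.blank] [] []) .out ((l.map LeafSym.toΓ').reverse ++ w))
      (4 * l.length + 1) := by
    intro l
    induction l with
    | nil => exact fun w => .loop_done rfl (by simp)
    | cons x l ih =>
      intro w
      refine Runs.loop_step (by simp [enc, encList, BinTree.code]) (Runs.seq (.pop le_rfl)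
        (runs_moveTop (by simp) (x := x.toΓ') (l := (enc l).code) ?_) le_rfl)
        (Eq.subst (motive := fun S => Runs _ S _ _) ?_ ((ih (x.toΓ' :: w)).congr ?_)) ?_
      · simp [enc, encList, BinTree.code]
      · funext k
        cases k <;> simp [store]
      · simp
      · simp only [List.length_cons]
        omega
  refine (Runs.seq (S₁ := Function.update (store [Γ'.blank] [] []) .out
    (l.map LeafSym.toΓ').reverse) (Eq.subst (motive := fun S => Runs _ S _ _) ?_
    ((key l []).congr (by simp))) (.pop le_rfl) (by omega)).congr ?_
  · funext k
    cases k <;> simp [store]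
  · funext k
    cases k <;> simp [store]

end Prog

theorem tsize_symbols (l : List LeafSym) : tsize l = 2 * l.length + 1 := by
  induction l with
  | nil => rfl
  | cons x l ih => simp [ih]; omega

open Prog in
theorem PolyTime.nonempty_computable {f : List LeafSym → List LeafSym} (hf : PolyTime f)
    {α β : Type} (ea : α → List Γ') (eb : β → List Γ') (g : α → β)
    (h : ∀ a, (f ((ea a).map LeafSym.ofΓ')).map LeafSym.toΓ' = eb (g a)) :
    Nonempty (TM2ComputableInPolyTime ea eb g) := by
  -- Reading and writing each reverse the word, which the two reversals compensate.
  have h₁ : PolyTime fun l : List LeafSym => (f l.reverse).reverse := by fun_prop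
  obtain ⟨P, p, hp⟩ := h₁
  refine Prog.nonempty_computable (seq readInput (seq P writeOutput)) ea eb g
    (4 * Polynomial.X + 5 * p.comp (2 * Polynomial.X + 1) + 10) fun a => ?_
  set l := ((ea a).map LeafSym.ofΓ').reverse with hl
  have h₂ := hp l
  have h₃ : tsize l = 2 * (ea a).length + 1 := by simp [tsize_symbols, hl]
  have h₄ := length_lt_tsize (f l.reverse).reverse
  rw [h₃] at h₂
  refine (Runs.seq (runs_readInput (ea a)) (Runs.seq (by simpa using h₂.1 [])
    (runs_writeOutput _) le_rfl) ?_).congr ?_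
  · have := h₂.2
    simp at this h₄ ⊢
    omega
  · rw [← h]
    simp [hl]

theorem mainTheorem4 (k : ℕ) :
    ∃ f : (I : FTPInstance.OnDAG) → Option (Finset (Fin I.1.m)),
      (∀ I : FTPInstance.OnDAG, I.1.IsAnswer k (f I)) ∧
      Nonempty (TM2ComputableInPolyTime
        (fun I : FTPInstance.OnDAG => I.1.encode)
        (fun w : List Γ' => w)
        (fun I : FTPInstance.OnDAG => FTPInstance.encodeAnswer (f I))) := by
  -- An optimal set need not be unique; `f` picks the one whose code the algorithm outputs.
  choose f hf hf' using fun I : FTPInstance.OnDAG => I.2.exists_isAnswer k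
  exact ⟨f, hf, ((PolyTime.solve k).comp PolyTime.parse).nonempty_computable _ _ _ hf'⟩
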